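/- **Setting.** Let $V$ be a finite set of $n$ users with an undirected friendship graph. Each ordered pair $(u,v)$ of friends has a weight $w_{(u,v)}\in(0,1]$, with $w_{(u,v)}=0$ for non-friends and $\sum_u w_{(u,v)}\le 1$ for every $v$. Let $s$ (initiator) and $t$ (target) be distinct users who are not friends, and let $N_s$ be the set of friends of $s$. The thresholds $\theta_v$ are independent and uniform on $[0,1]$. For an invitation set $I\subseteq V$ put $C_0=N_s$ and $$C_{i+1}=C_i\cup\{u\in I\setminus C_i:\ \textstyle\sum_{v\in C_i}w_{(v,u)}\ge\theta_u\}.$$ Let $f(I)$ be the probability that $t$ belongs to some $C_i$, and let $p_{max}=\max_I f(I)$; assume $p_{max}>0$. For $\alpha\in(0,1]$ let $I_\alpha$ be an optimal solution of Minimum Active Friending, i.e. a smallest $I\subseteq V$ with $f(I)\ge\alpha\,p_{max}$. **Realizations.** A random realization $g$ lets each user $v$ independently select the friend $u$ with probability $w_{(u,v)}$, and nobody with probability $1-\sum_u w_{(u,v)}$. Follow the selections from $t$. If this path reaches a user of $N_s$ (before it repeats a user or meets a user who selected nobody), $g$ is of type 1, and $t(g)$ denotes the set of users on the path, including $t$ and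 excluding that last user of $N_s$; otherwise $g$ is of type 0. **Subroutine.** For a finite family $U$ of subsets of $V$ (with multiplicity) and an integer $0\le p\le|U|$, Minimum Subset Cover asks for a smallest $J\subseteq V$ that contains at least $p$ members of $U$. A $2\sqrt{|U|}$-approximation always outputs a feasible set that is at most $2\sqrt{|U|}$ times as large as any feasible set. **RAF algorithm.** Input: $\alpha\in(0,1]$, $0<\epsilon<\alpha$, $N>0$. 1. Take $\epsilon_0,\epsilon_1\in(0,1)$ such that $\beta=\frac{\alpha-\epsilon_1(1+\epsilon_0)}{1+\epsilon_1(1+\epsilon_0)}>0$ and $\beta\,(1-\epsilon_1(1+\epsilon_0))-\epsilon_1(1+\epsilon_0)=\alpha-\epsilon$. 2. Put $\Upsilon=1+\frac{4(e-2)(1+\epsilon_0)\ln(2N)}{\epsilon_0^2}$. Draw independent realizations until the number of type-1 ones exceeds $\Upsilon$, say after $i$ draws, and put $p^*_{max}=\Upsilon/i$. 3. Draw $l=\lceil l^*\rceil$ further independent realizations, where $$l^*=\frac{(\ln2+\ln N+n\ln2)\,(2+\epsilon_1(1-\epsilon_0))}{\epsilon_1^2(1-\epsilon_0)^2\,p^*_{max}},$$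 and let $U$ be the family of the sets $t(g)$ of the type-1 ones among them. Return the output $I^*$ of the subroutine on $U$ and $p=\lceil\beta|U|\rceil$. **Theorem.** (a) For all $\alpha\in(0,1]$ and $0<\epsilon<\alpha$, parameters $\epsilon_0,\epsilon_1$ as in step 1 exist. (b) The Chlamtáč algorithm is a $2\sqrt{|U|}$-approximation for Minimum Subset Cover. Here the Chlamtáč algorithm is: while more than $\sqrt{|U|}$ sets remain to be chosen, choose a nonempty subfamily of the remaining sets that adds the fewest new elements per set; then choose as many remaining sets with the fewest new elements as are still needed; output the union. (c) Let $\epsilon_0,\epsilon_1\in(0,1)$, $c\in\mathbb R$ and $K\in\mathbb N$. There is a constant $C$, depending only on $\epsilon_0,\epsilon_1,c,K$, such that for all $\alpha,\epsilon$ for which $\epsilon_0,\epsilon_1$ are as in step 1, every network and pair $s,t$ as above, every $2\sqrt{|U|}$-approximation used as the subroutine (in particular the Chlamtáč algorithm), every $0<N\le c\,n^K$ and every optimal $I_\alpha$, with probability at least $1-2/N$ the RAF algorithm terminates and returns an invitation set $I^*$ with $$f(I^*)\ \ge\ (\alpha-\epsilon)\,p_{max}\qquad\text{and}\qquad |I^*|\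 \le\ C\sqrt n\;|I_\alpha| .$$ -/

import Mathlib

open MeasureTheory

namespace ActiveFriending

/-! ### The social network and the friending process -/

/-- A weighted undirected friendship graph on the user set `V`. The weight `w u v` is the
familiarity of `v` with `u`; it lies in `(0, 1]` for friends, it is `0` for non-friends, it need
not be symmetric, and the weights into each user sum to at most one. -/
structure SocialNetwork (V : Type*) [Fintype V] where
  graph : SimpleGraph V
  w : V → V → ℝ
  w_pos : ∀ u v, graph.Adj u v → 0 < w u v
  w_le_one : ∀ u v, graph.Adj u v → w u v ≤ 1
  w_eq_zero : ∀ u v, ¬ graph.Adj u v → w u v = 0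
  sum_w_le_one : ∀ v, ∑ u, w u v ≤ 1

section Friending

variable {V : Type*} [Fintype V] [DecidableEq V]

open Classical in
/-- `N_s`, the current friends of the user `s`. -/
noncomputable def SocialNetwork.friendsOf (G : SocialNetwork V) (s : V) : Finset V :=
  Finset.univ.filter (fun u => G.graph.Adj u s)

open Classical in
/-- `Φ(C)`: the users outside `C` who are willing to become friends of a user whose current
friends are `C`, when the thresholds are `θ`. -/
noncomputable def SocialNetwork.willing (G : SocialNetwork V) (θ : V → ℝ) (C : Finset V) :
    Finset V :=
  Finset.univ.filter (fun u => u ∉ C ∧ θ u ≤ ∑ v ∈ C, G.w v u)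

/-- `C_i(I)`: the friends of the initiator `s` after `i` rounds, with invitation set `I`. -/
noncomputable def SocialNetwork.friendsAt (G : SocialNetwork V) (s : V) (I : Finset V)
    (θ : V → ℝ) : ℕ → Finset V
  | 0 => G.friendsOf s
  | i + 1 => G.friendsAt s I θ i ∪ (G.willing θ (G.friendsAt s I θ i) ∩ I)

/-- The friending process succeeds: `t ∈ C_∞(I)`. The process stops at the first round at which
`t` is a friend or no invited user is willing any more (from then on the sets `C_i(I)` are
constant), so `t` belongs to the final set exactly if it belongs to some `C_i(I)`. -/
def SocialNetwork.Succeeds (G : SocialNetwork V) (s t : V) (I : Finset V) (θ : V → ℝ) : Prop :=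
  ∃ i, t ∈ G.friendsAt s I θ i

/-- The law of the thresholds: independent and uniform on `[0, 1]`. -/
noncomputable def thresholdLaw (V : Type*) [Fintype V] : Measure (V → ℝ) :=
  Measure.pi (fun _ => volume.restrict (Set.Icc (0 : ℝ) 1))

/-- `f(I)`, the acceptance probability of the invitation set `I`. -/
noncomputable def SocialNetwork.acceptProb (G : SocialNetwork V) (s t : V) (I : Finset V) : ℝ :=
  (thresholdLaw V).real {θ | G.Succeeds s t I θ}

/-- `p_max`, the largest acceptance probability over all invitation sets. -/
noncomputable def SocialNetwork.pMax (G : SocialNetwork V) (s t : V) : ℝ :=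
  ⨆ I : Finset V, G.acceptProb s t I

/-- `I` is an optimal solution of Minimum Active Friending with ratio `α`: a smallest invitation
set with `f(I) ≥ α * p_max`. -/
def SocialNetwork.IsOptimal (G : SocialNetwork V) (s t : V) (α : ℝ) (I : Finset V) : Prop :=
  α * G.pMax s t ≤ G.acceptProb s t I ∧
    ∀ J : Finset V, α * G.pMax s t ≤ G.acceptProb s t J → I.card ≤ J.card

end Friending

/-! ### Random realizations and backward traces -/

section Realization

/-- The discrete σ-algebra on the possible selections of one user. -/
instance instMeasurableSpaceSelection {V : Type*} : MeasurableSpace (Option V) := ⊤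

variable {V : Type*} [Fintype V]

/-- The probability that `v` selects `u` (`some u`), or nobody (`none`). -/
def SocialNetwork.selectProb (G : SocialNetwork V) (v : V) : Option V → ℝ
  | some u => G.w u v
  | none => 1 - ∑ u, G.w u v

theorem SocialNetwork.w_nonneg (G : SocialNetwork V) (u v : V) : 0 ≤ G.w u v := by
  by_cases h : G.graph.Adj u v
  · exact (G.w_pos u v h).le
  · exact (G.w_eq_zero u v h).ge

theorem SocialNetwork.selectProb_nonneg (G : SocialNetwork V) (v : V) (o : Option V) :
    0 ≤ G.selectProb v o := by
  cases o with
  | none => exact sub_nonneg.2 (G.sum_w_le_one v)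
  | some u => exact G.w_nonneg u v

theorem SocialNetwork.sum_selectProb (G : SocialNetwork V) (v : V) :
    ∑ o, ENNReal.ofReal (G.selectProb v o) = 1 := by
  rw [← ENNReal.ofReal_sum_of_nonneg (fun o _ => G.selectProb_nonneg v o),
    Fintype.sum_option]
  simp [SocialNetwork.selectProb]

/-- The law of the selection of the user `v`. -/
noncomputable def SocialNetwork.selectPMF (G : SocialNetwork V) (v : V) : PMF (Option V) :=
  PMF.ofFintype (fun o => ENNReal.ofReal (G.selectProb v o)) (G.sum_selectProb v)

/-- The law of a random realization `g`: the users select independently. The value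
`g v = none` means that `v` selects no user. -/
noncomputable def SocialNetwork.realizationLaw (G : SocialNetwork V) : Measure (V → Option V) :=
  Measure.pi (fun v => (G.selectPMF v).toMeasure)

noncomputable instance (G : SocialNetwork V) : IsProbabilityMeasure G.realizationLaw := by
  unfold SocialNetwork.realizationLaw
  infer_instance

variable [DecidableEq V]

/-- The loop of the backward trace from the target: `T` is the current set, `u` the current
user, `N` the set of friends of the initiator. The first argument bounds the number of
iterations. The result `none` means that the trace meets the artificial user. -/
def traceLoop (N : Finset V) (g : V → Option V) : ℕ → Finset V → V → Option (Finset V)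
  | 0, _, _ => none
  | k + 1, T, u =>
    match g u with
    | none => none
    | some v =>
      if v ∈ T then none
      else if v ∈ N then some T
      else traceLoop N g k (insert v T) v

/-- `t(g)`: it is `some T` if `g` is a type-1 realization with `t(g) = T`, and `none` if `g` is a
type-0 realization. Each iteration enlarges the current set, which starts with one user, so
`|V|` iterations always reach a return instruction. -/
noncomputable def SocialNetwork.trace (G : SocialNetwork V) (s t : V) (g : V → Option V) :
    Option (Finset V) :=
  traceLoop (G.friendsOf s) g (Fintype.card V) {t} t

end Realization

/-! ### Minimum Subset Cover -/

section MSC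

variable {V : Type*} [DecidableEq V]

/-- The number of members of the family `U` (with multiplicity) covered by `I`. -/
def coverCount (U : Multiset (Finset V)) (I : Finset V) : ℕ :=
  U.countP (fun T => T ⊆ I)

/-- `A` is a `2 √|U|`-approximation for Minimum Subset Cover: for every family `U` and every
`p ≤ |U|`, its output covers at least `p` members of `U`, and it is at most `2 √|U|` times as
large as any set that does so. -/
def IsMSCApprox (A : Multiset (Finset V) → ℕ → Finset V) : Prop :=
  ∀ (U : Multiset (Finset V)) (p : ℕ), p ≤ U.card →
    p ≤ coverCount U (A U p) ∧
    ∀ J : Finset V, p ≤ coverCount U J →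
      ((A U p).card : ℝ) ≤ 2 * √(U.card : ℝ) * (J.card : ℝ)

open Classical in
/-- A minimizer of `c` over the finite set `S` (and `d` if `S` is empty). -/
noncomputable def argminOn {β : Type*} (S : Finset β) (c : β → ℚ) (d : β) : β :=
  if h : S.Nonempty then (S.exists_min_image c h).choose else d

/-- The number of elements that the subfamily `Q` adds to the union of the chosen family `S`. -/
def newElements (S Q : Multiset (Finset V)) : ℕ :=
  (Q.sup \ S.sup).card

/-- A nonempty subfamily of the remaining family `R` of least expansion, that is, adding the
fewest new elements per set. -/
noncomputable def leastExpanding (S R : Multiset (Finset V)) : Multiset (Finset V) :=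
  argminOn (R.powerset.toFinset.filter (fun Q => Q ≠ 0))
    (fun Q => (newElements S Q : ℚ) / (Q.card : ℚ)) 0

open Classical in
/-- One greedy step on a pair (chosen family, remaining family): as long as more than `√m` sets
are still to be chosen, move a least expanding subfamily to the chosen family. -/
noncomputable def greedyStep (m p : ℕ)
    (SR : Multiset (Finset V) × Multiset (Finset V)) :
    Multiset (Finset V) × Multiset (Finset V) :=
  if √(m : ℝ) < (p : ℝ) - (SR.1.card : ℝ) then
    (SR.1 + leastExpanding SR.1 SR.2, SR.2 - leastExpanding SR.1 SR.2)
  else SR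

/-- The Chlamtáč algorithm: greedily pick least expanding subfamilies while more than `√|U|` sets
are to be chosen, then complete with the remaining sets that have the fewest new elements, and
return the union. Every effective greedy step moves at least one set, so `|U|` steps suffice. -/
noncomputable def chlamtac (U : Multiset (Finset V)) (p : ℕ) : Finset V :=
  let SR := (greedyStep U.card p)^[U.card] (0, U)
  let L := argminOn (SR.2.powersetCard (p - SR.1.card)).toFinset
    (fun L => ((L.map (fun T => newElements SR.1 {T})).sum : ℚ)) 0
  (SR.1 + L).sup

end MSC

/-! ### The RAF algorithm -/

section RAF

variable {V : Type*} [Fintype V] [DecidableEq V]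

/-- The parameter `β` determined by `α`, `ε₀` and `ε₁`. -/
noncomputable def betaParam (α ε₀ ε₁ : ℝ) : ℝ :=
  (α - ε₁ * (1 + ε₀)) / (1 + ε₁ * (1 + ε₀))

/-- The parameters `ε₀, ε₁ ∈ (0, 1)` solve the system that fixes them from `α` and `ε`. -/
def Admissible (α ε ε₀ ε₁ : ℝ) : Prop :=
  0 < ε₀ ∧ ε₀ < 1 ∧ 0 < ε₁ ∧ ε₁ < 1 ∧ 0 < betaParam α ε₀ ε₁ ∧
    betaParam α ε₀ ε₁ * (1 - ε₁ * (1 + ε₀)) - ε₁ * (1 + ε₀) = α - ε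

/-- The threshold of the stopping rule that estimates `p_max` within the relative error `ε₀` with
probability at least `1 - 1/N`. -/
noncomputable def upsilon (ε₀ N : ℝ) : ℝ :=
  1 + 4 * (Real.exp 1 - 2) * (1 + ε₀) * Real.log (2 * N) / ε₀ ^ 2

/-- The number of type-1 realizations among the first `i` ones of the stream `g`. -/
noncomputable def SocialNetwork.typeOneCount (G : SocialNetwork V) (s t : V)
    (g : ℕ → V → Option V) (i : ℕ) : ℕ :=
  ((Finset.range i).filter (fun k => (G.trace s t (g k)).isSome)).card

open Classical in
/-- The estimate of `p_max`: draw realizations until the number of type-1 ones exceeds the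
threshold, and return the threshold divided by the number of draws (`none`: no termination). -/
noncomputable def SocialNetwork.estimate (G : SocialNetwork V) (s t : V) (ε₀ N : ℝ)
    (g : ℕ → V → Option V) : Option ℝ :=
  if h : ∃ i, upsilon ε₀ N < (G.typeOneCount s t g i : ℝ) then
    some (upsilon ε₀ N / (Nat.find h : ℝ))
  else none

/-- The sample size `l*`, for `n` users and the estimate `q` of `p_max`. -/
noncomputable def sampleSize (n : ℕ) (ε₀ ε₁ N q : ℝ) : ℝ :=
  (Real.log 2 + Real.log N + n * Real.log 2) * (2 + ε₁ * (1 - ε₀)) /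
    (ε₁ ^ 2 * (1 - ε₀) ^ 2 * q)

/-- The family of the traces of the type-1 realizations among the first `l` ones of `g`. -/
noncomputable def SocialNetwork.typeOneFamily (G : SocialNetwork V) (s t : V)
    (g : ℕ → V → Option V) (l : ℕ) : Multiset (Finset V) :=
  (Multiset.range l).filterMap (fun k => G.trace s t (g k))

/-- The sampling framework with parameters `β` and `l` and the Minimum Subset Cover subroutine
`A`. -/
noncomputable def SocialNetwork.framework (G : SocialNetwork V) (s t : V)
    (A : Multiset (Finset V) → ℕ → Finset V) (β : ℝ) (l : ℕ) (g : ℕ → V → Option V) : Finset V :=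
  A (G.typeOneFamily s t g l) ⌈β * ((G.typeOneFamily s t g l).card : ℝ)⌉₊

/-- The output of RAF. The random input consists of two streams of realizations, one for the
estimate of `p_max` and one for the framework (`none`: no termination). -/
noncomputable def SocialNetwork.raf (G : SocialNetwork V) (s t : V)
    (A : Multiset (Finset V) → ℕ → Finset V) (α ε₀ ε₁ N : ℝ)
    (ω : (ℕ → V → Option V) × (ℕ → V → Option V)) : Option (Finset V) :=
  (G.estimate s t ε₀ N ω.1).map (fun q =>
    G.framework s t A (betaParam α ε₀ ε₁) ⌈sampleSize (Fintype.card V) ε₀ ε₁ N q⌉₊ ω.2)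

/-- The law of the random input of RAF: two independent streams of independent realizations. -/
noncomputable def SocialNetwork.sampleLaw (G : SocialNetwork V) :
    Measure ((ℕ → V → Option V) × (ℕ → V → Option V)) :=
  (Measure.infinitePi (fun _ : ℕ => G.realizationLaw)).prod
    (Measure.infinitePi (fun _ : ℕ => G.realizationLaw))

end RAF

end ActiveFriending

/-!
**Acceptance probabilities are coverage probabilities.** Fix an invitation set. Both the
threshold process and a realization activate users by a monotone rule, and in both a set `D` of
users activates `u` with probability `∑ v ∈ D, w v u`, independently over `u`. If all rules but
that of `u` are fixed, then whether `t` is reached depends on the rule of `u` at one set only, the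
final set of the process without `u` (`reaches_update_iff`). So the rules can be exchanged one user
at a time (`SocialNetwork.pi_jointLaw_insert`). For realizations, reaching `t` means that the trace
exists and consists of invited users (`SocialNetwork.covered_iff_reaches`). Hence `f(I)` is the
probability that the trace is contained in `I`, and `p_max = f(V)` is the probability of type 1.

**Sampling.** Put `x = ε₁ (1 + ε₀)`. The number of samples with a given property is binomial, and
Chernoff bounds show two things. The stopping rule returns a `(1 ± ε₀)`-estimate of `p_max` with
probability at least `1 - 1/N` (`measureReal_not_estimate_le`). For such an estimate, `l` further
samples suffice for all `2 ^ n` empirical rates to be within `x p_max` of `f(I)`, again with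
probability at least `1 - 1/N` (`SocialNetwork.measureReal_not_uniform_le`). The two streams are
independent, so `l` may depend on the first (`prod_real_exists_le`).

**Conclusion on the good event.** The choice `β = (α - x) / (1 + x)` makes `I_α` feasible for
Minimum Subset Cover, so the output has at most `2 √|U| |I_α|` elements, and a set covering `β |U|`
traces has acceptance probability at least `(β (1 - x) - x) p_max = (α - ε) p_max`
(`SocialNetwork.framework_spec`). Finally `|U| ≤ (1 + x) l p_max = O(n)`, because `l p_max` is
bounded by a multiple of `n + ln N` (`ceil_sampleSize_mul_le`).

**The subroutine.** While more than `√|U|` sets are needed, the remaining sets inside a feasible `J`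
are more than `√|U|` in number and add at most `|J|` elements together. So a least expanding
subfamily adds at most `|J| / √|U|` elements per set, at most `√|U| |J|` over the whole phase, and
the last at most `√|U|` sets add at most `|J|` each (`isMSCApprox_chlamtac`).
-/

namespace ActiveFriending

/-! ### Activation as a least fixed point -/

section Activation

variable {V : Type*}

/-- `D` contains the seeds `N` and every invited user which it activates. The rule `a u D` says
that the set `D` activates the user `u`. -/
def ClosedUnder (N I : Finset V) (a : V → Finset V → Prop) (D : Finset V) : Prop :=
  N ⊆ D ∧ ∀ u ∈ I, a u D → u ∈ D

/-- The user `t` lies in the final set of the activation process with seeds `N`, invitations `I`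
and rule `a`, encoded as the intersection of all closed sets. For a monotone rule this is the
limit of the round-by-round process. -/
def Reaches (N I : Finset V) (a : V → Finset V → Prop) (t : V) : Prop :=
  ∀ D, ClosedUnder N I a D → t ∈ D

theorem Reaches.mono {N I : Finset V} {a b : V → Finset V → Prop} {t : V}
    (hab : ∀ u D, a u D → b u D) (h : Reaches N I a t) : Reaches N I b t :=
  fun D hD => h D ⟨hD.1, fun u hu ha => hD.2 u hu (hab u D ha)⟩

variable [Fintype V]

open Classical in
/-- The final set of the activation process. -/
noncomputable def finalSet (N I : Finset V) (a : V → Finset V → Prop) : Finset V :=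
  Finset.univ.filter (fun t => Reaches N I a t)

theorem mem_finalSet {N I : Finset V} {a : V → Finset V → Prop} {t : V} :
    t ∈ finalSet N I a ↔ Reaches N I a t := by
  simp [finalSet]

theorem finalSet_subset {N I : Finset V} {a : V → Finset V → Prop} {D : Finset V}
    (hD : ClosedUnder N I a D) : finalSet N I a ⊆ D :=
  fun _ ht => mem_finalSet.1 ht D hD

theorem closedUnder_finalSet {N I : Finset V} {a : V → Finset V → Prop}
    (ha : ∀ u, Monotone (a u)) : ClosedUnder N I a (finalSet N I a) :=
  ⟨fun _ hv => mem_finalSet.2 fun _ hD => hD.1 hv,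
    fun u hu hau => mem_finalSet.2 fun _ hD => hD.2 u hu (ha u (finalSet_subset hD) hau)⟩

/-- The rule of a single user `u` enters the process only once: whether `u` is activated is
decided by the final set of the process in which `u` never joins. -/
theorem reaches_update_iff [DecidableEq V] {N I : Finset V} {a : V → Finset V → Prop} {t u : V}
    (ha : ∀ v, Monotone (a v)) {b : Finset V → Prop} (hb : Monotone b) :
    Reaches N I (Function.update a u b) t ↔
      Reaches N I (Function.update a u fun _ => False) t ∨
        (Reaches N I (Function.update a u fun _ => True) t ∧
          b (finalSet N I (Function.update a u fun _ => False))) := by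
  have hmono : ∀ v, Monotone (Function.update a u (fun _ => False) v) := by
    intro v
    by_cases hv : v = u
    · subst hv; simpa using monotone_const
    · simpa [hv] using ha v
  have hle : ∀ (c d : Finset V → Prop), (∀ D, c D → d D) → ∀ v D,
      Function.update a u c v D → Function.update a u d v D := by
    intro c d hcd v D
    by_cases hv : v = u
    · subst hv; simpa using hcd D
    · simp [hv]
  constructor
  · intro h
    by_cases h0 : Reaches N I (Function.update a u fun _ => False) t
    · exact Or.inl h0
    refine Or.inr ⟨h.mono (hle _ _ fun _ _ => trivial), ?_⟩
    by_contra hbC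
    refine h0 (mem_finalSet.1 (h _ ⟨(closedUnder_finalSet hmono).1, fun v hv hav => ?_⟩))
    by_cases hvu : v = u
    · subst hvu
      exact absurd (by simpa using hav) hbC
    · exact (closedUnder_finalSet hmono).2 v hv (by simpa [hvu] using hav)
  · rintro (h | ⟨h, hbC⟩)
    · exact h.mono (hle _ _ fun _ h => h.elim)
    · intro D hD
      have hsub : finalSet N I (Function.update a u fun _ => False) ⊆ D :=
        finalSet_subset ⟨hD.1, fun v hv hav => hD.2 v hv (hle _ _ (fun _ h => h.elim) v D hav)⟩
      refine h D ⟨hD.1, fun v hv hav => ?_⟩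
      by_cases hvu : v = u
      · subst hvu
        exact hD.2 v hv (by simpa using hb hsub hbC)
      · exact hD.2 v hv (by simpa [hvu] using hav)

end Activation

/-! ### The two activation rules -/

section Rules

variable {V : Type*}

/-- The rule of a realization: the selected user has joined. -/
def selectionRule (g : V → Option V) (u : V) (D : Finset V) : Prop :=
  ∃ v ∈ D, g u = some v

theorem monotone_selectionRule (g : V → Option V) (u : V) : Monotone (selectionRule g u) :=
  fun _ _ h ⟨v, hv, hg⟩ => ⟨v, h hv, hg⟩

section Trace

variable [DecidableEq V]

theorem subset_of_traceLoop_eq_some {N : Finset V} {g : V → Option V} {k : ℕ} {T T' : Finset V}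
    {u : V} (h : traceLoop N g k T u = some T') : T ⊆ T' := by
  induction k generalizing T u with
  | zero => simp [traceLoop] at h
  | succ k ih =>
    rw [traceLoop] at h
    split at h
    · simp at h
    · split_ifs at h
      · exact (Option.some.inj h).le
      · exact (Finset.subset_insert _ _).trans (ih h)

theorem mem_of_traceLoop_eq_some {N I D : Finset V} {g : V → Option V} {k : ℕ} {T T' : Finset V}
    {u : V} (h : traceLoop N g k T u = some T') (hu : u ∈ T) (hT' : T' ⊆ I)
    (hD : ClosedUnder N I (selectionRule g) D) : u ∈ D := by
  induction k generalizing T u with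
  | zero => simp [traceLoop] at h
  | succ k ih =>
    have huI : u ∈ I := hT' (subset_of_traceLoop_eq_some h hu)
    rw [traceLoop] at h
    split at h
    · simp at h
    · rename_i v hv
      split_ifs at h with h1 h2
      · exact hD.2 u huI ⟨v, hD.1 h2, hv⟩
      · exact hD.2 u huI ⟨v, ih h (Finset.mem_insert_self _ _), hv⟩

end Trace

variable [Fintype V]

/-- The rule of the friending process: the weights of the friends reach the threshold. -/
def SocialNetwork.thresholdRule (G : SocialNetwork V) (θ : V → ℝ) (u : V) (D : Finset V) : Prop :=
  θ u ≤ ∑ v ∈ D, G.w v u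

theorem SocialNetwork.monotone_thresholdRule (G : SocialNetwork V) (θ : V → ℝ) (u : V) :
    Monotone (G.thresholdRule θ u) :=
  fun _ _ h h' => le_trans h' (Finset.sum_le_sum_of_subset_of_nonneg h
    fun v _ _ => G.w_nonneg v u)

variable [DecidableEq V]

theorem SocialNetwork.succeeds_iff_reaches (G : SocialNetwork V) (s t : V) (I : Finset V)
    (θ : V → ℝ) :
    G.Succeeds s t I θ ↔ Reaches (G.friendsOf s) I (G.thresholdRule θ) t := by
  classical
  constructor
  · rintro ⟨i, hi⟩ D hD
    have key : ∀ i, G.friendsAt s I θ i ⊆ D := by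
      intro i
      induction i with
      | zero => exact hD.1
      | succ i ih =>
        refine Finset.union_subset ih fun u hu => ?_
        simp only [SocialNetwork.willing, Finset.mem_inter, Finset.mem_filter] at hu
        exact hD.2 u hu.2 (G.monotone_thresholdRule θ u ih hu.1.2.2)
    exact key i hi
  · intro h
    have hmono : Monotone (G.friendsAt s I θ) :=
      monotone_nat_of_le_succ fun i => Finset.subset_union_left
    have hmem : ∀ u ∈ Finset.univ.filter (fun u => ∃ i, u ∈ G.friendsAt s I θ i),
        ∃ i, u ∈ G.friendsAt s I θ i := fun u hu => (Finset.mem_filter.1 hu).2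
    have hsub : ∃ i, Finset.univ.filter (fun u => ∃ i, u ∈ G.friendsAt s I θ i) ⊆
        G.friendsAt s I θ i := by
      choose! r hr using hmem
      refine ⟨(Finset.univ.filter (fun u => ∃ i, u ∈ G.friendsAt s I θ i)).sup r, fun u hu => ?_⟩
      exact hmono (Finset.le_sup hu) (hr u hu)
    obtain ⟨i, hi⟩ := hsub
    refine hmem t (h _ ⟨fun u hu => ?_, fun u hu hau => ?_⟩)
    · exact Finset.mem_filter.2 ⟨Finset.mem_univ _, 0, hu⟩
    · refine Finset.mem_filter.2 ⟨Finset.mem_univ _, i + 1, ?_⟩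
      have hau' := G.monotone_thresholdRule θ u hi hau
      simp only [SocialNetwork.friendsAt, SocialNetwork.willing, Finset.mem_union,
        Finset.mem_inter, Finset.mem_filter]
      by_cases hC : u ∈ G.friendsAt s I θ i
      · exact Or.inl hC
      · exact Or.inr ⟨⟨Finset.mem_univ _, hC, hau'⟩, hu⟩

/-- If the trace were to get stuck, or to pass through a user who is not invited, then the
complement of the set of traced users would be closed and miss `t`. -/
theorem exists_traceLoop_eq_some {N I : Finset V} {g : V → Option V} {t : V}
    (ht : Reaches N I (selectionRule g) t) {k : ℕ} {T : Finset V} {u : V}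
    (hk : Fintype.card V < T.card + k) (htT : t ∈ T) (hu : u ∈ T) (hN : Disjoint N T)
    (hT : ∀ x ∈ T, x ≠ u → x ∈ I ∧ ∃ y ∈ T, g x = some y) :
    ∃ T', traceLoop N g k T u = some T' ∧ T' ⊆ I := by
  induction k generalizing T u with
  | zero => exact absurd hk (by simpa using T.card_le_univ)
  | succ k ih =>
    obtain ⟨huI, v, hvT, hv⟩ : u ∈ I ∧ ∃ v, v ∉ T ∧ g u = some v := by
      by_contra hcon
      have hcl : ClosedUnder N I (selectionRule g) Tᶜ := by
        refine ⟨fun x hx => Finset.mem_compl.2 (Finset.disjoint_left.1 hN hx), ?_⟩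
        rintro x hxI ⟨y, hy, hgx⟩
        refine Finset.mem_compl.2 fun hxT => ?_
        by_cases hxu : x = u
        · subst hxu
          exact hcon ⟨hxI, y, Finset.mem_compl.1 hy, hgx⟩
        · obtain ⟨-, z, hz, hgz⟩ := hT x hxT hxu
          rw [hgx] at hgz
          exact Finset.mem_compl.1 hy (Option.some.inj hgz ▸ hz)
      exact Finset.mem_compl.1 (ht _ hcl) htT
    have hTI : ∀ x ∈ T, x ∈ I := fun x hx => by
      by_cases hxu : x = u
      · exact hxu ▸ huI
      · exact (hT x hx hxu).1
    rw [traceLoop]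
    simp only [hv, hvT, if_false]
    by_cases hvN : v ∈ N
    · exact ⟨T, by simp [hvN], hTI⟩
    simp only [hvN, if_false]
    refine ih ?_ (Finset.mem_insert_of_mem htT) (Finset.mem_insert_self _ _)
      (Finset.disjoint_insert_right.2 ⟨hvN, hN⟩) ?_
    · rw [Finset.card_insert_of_notMem hvT]; omega
    · intro x hx hxv
      have hxT := Finset.mem_of_mem_insert_of_ne hx hxv
      refine ⟨hTI x hxT, ?_⟩
      by_cases hxu : x = u
      · exact ⟨v, Finset.mem_insert_self _ _, hxu ▸ hv⟩
      · obtain ⟨-, y, hy, hgy⟩ := hT x hxT hxu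
        exact ⟨y, Finset.mem_insert_of_mem hy, hgy⟩

/-- The realizations of type 1 whose trace `t(g)` is contained in the invitation set `I`. -/
def SocialNetwork.Covered (G : SocialNetwork V) (s t : V) (I : Finset V)
    (g : V → Option V) : Prop :=
  ∃ T, G.trace s t g = some T ∧ T ⊆ I

theorem SocialNetwork.covered_iff_reaches (G : SocialNetwork V) {s t : V}
    (hst : ¬ G.graph.Adj s t) (I : Finset V) (g : V → Option V) :
    G.Covered s t I g ↔ Reaches (G.friendsOf s) I (selectionRule g) t := by
  constructor
  · rintro ⟨T, hT, hTI⟩ D hD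
    exact mem_of_traceLoop_eq_some hT (Finset.mem_singleton_self t) hTI hD
  · intro h
    refine exists_traceLoop_eq_some h (by simp) (Finset.mem_singleton_self t)
      (Finset.mem_singleton_self t) ?_ ?_
    · simp only [Finset.disjoint_singleton_right, SocialNetwork.friendsOf, Finset.mem_filter,
        Finset.mem_univ, true_and]
      exact fun h => hst h.symm
    · intro x hx hxt
      exact absurd (Finset.mem_singleton.1 hx) hxt

end Rules

/-! ### Acceptance probability and realizations -/

section Equivalence

variable {V : Type*}

instance : DiscreteMeasurableSpace (Option V) := ⟨fun _ => trivial⟩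

theorem measurableSet_selectionRule (D : Finset V) :
    MeasurableSet {y : ℝ × Option V | ∃ v ∈ D, y.2 = some v} :=
  measurable_snd (MeasurableSet.of_discrete (s := {o : Option V | ∃ v ∈ D, o = some v}))

variable [Fintype V]

/-- The joint law of a threshold and a selection for the user `u`, which are drawn
independently. Only one of the two is used at a time. -/
noncomputable def SocialNetwork.jointLaw (G : SocialNetwork V) (u : V) : Measure (ℝ × Option V) :=
  (volume.restrict (Set.Icc (0 : ℝ) 1)).prod (G.selectPMF u).toMeasure

instance : IsProbabilityMeasure (volume.restrict (Set.Icc (0 : ℝ) 1)) :=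
  ⟨by simp⟩

noncomputable instance (G : SocialNetwork V) (u : V) : IsProbabilityMeasure (G.jointLaw u) := by
  unfold SocialNetwork.jointLaw
  infer_instance

theorem SocialNetwork.measurableSet_thresholdRule (G : SocialNetwork V) (u : V) (D : Finset V) :
    MeasurableSet {y : ℝ × Option V | y.1 ≤ ∑ v ∈ D, G.w v u} :=
  measurableSet_le measurable_fst measurable_const

theorem SocialNetwork.jointLaw_threshold (G : SocialNetwork V) (u : V) (D : Finset V) :
    G.jointLaw u {y | y.1 ≤ ∑ v ∈ D, G.w v u} = ENNReal.ofReal (∑ v ∈ D, G.w v u) := by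
  have h1 : ∑ v ∈ D, G.w v u ≤ 1 :=
    (Finset.sum_le_sum_of_subset_of_nonneg D.subset_univ fun v _ _ => G.w_nonneg v u).trans
      (G.sum_w_le_one u)
  have h : {y : ℝ × Option V | y.1 ≤ ∑ v ∈ D, G.w v u} =
      Set.Iic (∑ v ∈ D, G.w v u) ×ˢ Set.univ := by
    ext; simp
  have hI : Set.Iic (∑ v ∈ D, G.w v u) ∩ Set.Icc (0 : ℝ) 1 = Set.Icc 0 (∑ v ∈ D, G.w v u) := by
    ext y
    simp only [Set.mem_inter_iff, Set.mem_Iic, Set.mem_Icc]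
    constructor
    · rintro ⟨h, h', -⟩; exact ⟨h', h⟩
    · rintro ⟨h, h'⟩; exact ⟨h', h, h'.trans h1⟩
  rw [h, SocialNetwork.jointLaw, Measure.prod_prod, measure_univ, mul_one,
    Measure.restrict_apply measurableSet_Iic, hI, Real.volume_Icc, sub_zero]

theorem SocialNetwork.jointLaw_selection (G : SocialNetwork V) (u : V) (D : Finset V) :
    G.jointLaw u {y | ∃ v ∈ D, y.2 = some v} = ENNReal.ofReal (∑ v ∈ D, G.w v u) := by
  have h : {y : ℝ × Option V | ∃ v ∈ D, y.2 = some v} =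
      Set.univ ×ˢ ((D.map Function.Embedding.some : Finset (Option V)) : Set (Option V)) := by
    ext y
    simp [eq_comm]
  rw [h, SocialNetwork.jointLaw, Measure.prod_prod, measure_univ, one_mul,
    PMF.toMeasure_apply_finset, Finset.sum_map,
    ENNReal.ofReal_sum_of_nonneg fun v _ => G.w_nonneg v u]
  rfl

variable [DecidableEq V]

/-- The rule in which the users in `F` follow their selection and all others their threshold. -/
def SocialNetwork.mixedRule (G : SocialNetwork V) (F : Finset V) (x : V → ℝ × Option V)
    (u : V) (D : Finset V) : Prop :=
  if u ∈ F then selectionRule (fun v => (x v).2) u D else G.thresholdRule (fun v => (x v).1) u D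

theorem SocialNetwork.monotone_mixedRule (G : SocialNetwork V) (F : Finset V)
    (x : V → ℝ × Option V) (u : V) : Monotone (G.mixedRule F x u) := by
  intro D D' h
  by_cases hu : u ∈ F
  · simpa only [SocialNetwork.mixedRule, hu, if_true] using
      monotone_selectionRule (fun v => (x v).2) u h
  · simpa only [SocialNetwork.mixedRule, hu, if_false] using
      G.monotone_thresholdRule (fun v => (x v).1) u h

theorem SocialNetwork.measurableSet_reaches_mixedRule (G : SocialNetwork V) (N I F : Finset V)
    (t : V) : MeasurableSet {x : V → ℝ × Option V | Reaches N I (G.mixedRule F x) t} := by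
  have hm : Measurable fun x : V → ℝ × Option V => G.mixedRule F x := by
    refine measurable_pi_lambda _ fun u => measurable_pi_lambda _ fun D => ?_
    refine measurable_to_prop ?_
    have : (fun x : V → ℝ × Option V => G.mixedRule F x u D) ⁻¹' {True} =
        {x | G.mixedRule F x u D} := by ext x; simp
    rw [this]
    by_cases hu : u ∈ F
    · simp only [SocialNetwork.mixedRule, hu, if_true, selectionRule]
      exact (measurableSet_selectionRule D).preimage (measurable_pi_apply u)
    · simp only [SocialNetwork.mixedRule, hu, if_false, SocialNetwork.thresholdRule]
      exact (G.measurableSet_thresholdRule u D).preimage (measurable_pi_apply u)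
  exact hm (MeasurableSet.of_discrete (s := {a : V → Finset V → Prop | Reaches N I a t}))

/-- Both rules let a set `D` activate `u` with probability `∑ v ∈ D, w v u`, and the process
consults the rule of `u` for one set only, which depends on the other users. Hence the rule of one
user can be exchanged without changing the probability that `t` is reached. -/
theorem SocialNetwork.pi_jointLaw_insert (G : SocialNetwork V) (N I F : Finset V) (t u : V) :
    Measure.pi G.jointLaw {x | Reaches N I (G.mixedRule (insert u F) x) t} =
      Measure.pi G.jointLaw {x | Reaches N I (G.mixedRule F x) t} := by
  by_cases hu : u ∈ F
  · rw [Finset.insert_eq_of_mem hu]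
  have hoff : ∀ (x : V → ℝ × Option V) (y : ℝ × Option V),
      G.mixedRule F (Function.update x u y) =
        Function.update (G.mixedRule F x) u (fun D => y.1 ≤ ∑ v ∈ D, G.w v u) := by
    intro x y
    funext v D
    by_cases hv : v = u
    · subst hv
      simp [SocialNetwork.mixedRule, hu, SocialNetwork.thresholdRule]
    · simp [SocialNetwork.mixedRule, hv, SocialNetwork.thresholdRule, selectionRule]
  have hon : ∀ (x : V → ℝ × Option V) (y : ℝ × Option V),
      G.mixedRule (insert u F) (Function.update x u y) =
        Function.update (G.mixedRule F x) u (fun D => ∃ v ∈ D, y.2 = some v) := by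
    intro x y
    funext v D
    by_cases hv : v = u
    · subst hv
      simp [SocialNetwork.mixedRule, selectionRule]
    · simp [SocialNetwork.mixedRule, hv, SocialNetwork.thresholdRule, selectionRule]
  -- The probability over the coordinate `u` only, all other coordinates being fixed.
  have hcoord : ∀ x : V → ℝ × Option V,
      G.jointLaw u {y | Reaches N I (G.mixedRule (insert u F) (Function.update x u y)) t} =
        G.jointLaw u {y | Reaches N I (G.mixedRule F (Function.update x u y)) t} := by
    intro x
    have hb1 : ∀ y : ℝ × Option V, Monotone fun D : Finset V => ∃ v ∈ D, y.2 = some v :=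
      fun y D D' h ⟨v, hv, hy⟩ => ⟨v, h hv, hy⟩
    have hb2 : ∀ y : ℝ × Option V, Monotone fun D : Finset V => y.1 ≤ ∑ v ∈ D, G.w v u :=
      fun y D D' h h' => G.monotone_thresholdRule (fun _ => y.1) u h h'
    simp only [hon, hoff, reaches_update_iff (G.monotone_mixedRule F x) (hb1 _),
      reaches_update_iff (G.monotone_mixedRule F x) (hb2 _)]
    by_cases hP : Reaches N I (Function.update (G.mixedRule F x) u fun _ => False) t
    · simp only [hP, true_or]
    by_cases hQ : Reaches N I (Function.update (G.mixedRule F x) u fun _ => True) t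
    · simp only [hP, hQ, false_or, true_and]
      rw [G.jointLaw_selection, G.jointLaw_threshold]
    · simp only [hP, hQ, false_and, or_false]
  have hmain : ∀ F' : Finset V,
      Measure.pi G.jointLaw {x | Reaches N I (G.mixedRule F' x) t} =
        (∫⋯∫⁻_Finset.univ.erase u, (fun x => G.jointLaw u
          {y | Reaches N I (G.mixedRule F' (Function.update x u y)) t}) ∂G.jointLaw)
            (fun _ => (0, none)) := by
    intro F'
    have hms := G.measurableSet_reaches_mixedRule N I F' t
    rw [← lintegral_indicator_one hms, lintegral_eq_lmarginal_univ (fun _ => (0, none)),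
      lmarginal_erase' _ (measurable_one.indicator hms) (Finset.mem_univ u)]
    congr 1
    funext x
    exact lintegral_indicator_one (hms.preimage (measurable_update x))
  rw [hmain, hmain]
  simp only [hcoord]

theorem SocialNetwork.pi_jointLaw_eq (G : SocialNetwork V) (N I F : Finset V) (t : V) :
    Measure.pi G.jointLaw {x | Reaches N I (G.mixedRule F x) t} =
      Measure.pi G.jointLaw {x | Reaches N I (G.mixedRule ∅ x) t} := by
  induction F using Finset.induction_on with
  | empty => rfl
  | insert u F _ ih => rw [G.pi_jointLaw_insert, ih]

/-- The acceptance probability of `I` is the probability that a random realization is of type 1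
with its trace contained in `I`. -/
theorem SocialNetwork.acceptProb_eq (G : SocialNetwork V) {s t : V} (hst : ¬ G.graph.Adj s t)
    (I : Finset V) :
    G.acceptProb s t I = G.realizationLaw.real {g | G.Covered s t I g} := by
  have hfst : MeasurePreserving (fun (x : V → ℝ × Option V) u => (x u).1)
      (Measure.pi G.jointLaw) (thresholdLaw V) :=
    measurePreserving_pi _ _ fun u => measurePreserving_fst
  have hsnd : MeasurePreserving (fun (x : V → ℝ × Option V) u => (x u).2)
      (Measure.pi G.jointLaw) G.realizationLaw :=
    measurePreserving_pi _ _ fun u => measurePreserving_snd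
  have hthrRule : ∀ x : V → ℝ × Option V,
      G.mixedRule ∅ x = G.thresholdRule fun v => (x v).1 := fun x => by
    funext u D
    simp [SocialNetwork.mixedRule]
  have hselRule : ∀ x : V → ℝ × Option V,
      G.mixedRule Finset.univ x = selectionRule fun v => (x v).2 := fun x => by
    funext u D
    simp [SocialNetwork.mixedRule]
  have hthr : MeasurableSet {θ : V → ℝ | Reaches (G.friendsOf s) I (G.thresholdRule θ) t} := by
    have hm : Measurable fun θ : V → ℝ => (fun u => (θ u, (none : Option V))) :=
      measurable_pi_lambda _ fun u => (measurable_pi_apply u).prodMk measurable_const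
    have := hm (G.measurableSet_reaches_mixedRule (G.friendsOf s) I ∅ t)
    simpa only [hthrRule, Set.preimage_ofPred_eq] using this
  have h1 := hfst.measure_preimage hthr.nullMeasurableSet
  have h2 := hsnd.measure_preimage (MeasurableSet.of_discrete
    (s := {g : V → Option V | Reaches (G.friendsOf s) I (selectionRule g) t})).nullMeasurableSet
  have h3 := G.pi_jointLaw_eq (G.friendsOf s) I Finset.univ t
  simp only [hthrRule, hselRule] at h3
  simp only [SocialNetwork.acceptProb, G.succeeds_iff_reaches, G.covered_iff_reaches hst,
    Measure.real]
  rw [← h1, ← h2]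
  exact congrArg ENNReal.toReal h3.symm

theorem SocialNetwork.acceptProb_le_pMax (G : SocialNetwork V) (s t : V) (I : Finset V) :
    G.acceptProb s t I ≤ G.pMax s t :=
  le_ciSup (f := G.acceptProb s t) (Set.finite_range _).bddAbove I

theorem SocialNetwork.covered_univ (G : SocialNetwork V) (s t : V) :
    {g | G.Covered s t Finset.univ g} = {g | (G.trace s t g).isSome} := by
  ext g
  simp [SocialNetwork.Covered, Option.isSome_iff_exists]

theorem SocialNetwork.acceptProb_univ (G : SocialNetwork V) {s t : V}
    (hst : ¬ G.graph.Adj s t) : G.acceptProb s t Finset.univ = G.pMax s t := by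
  refine le_antisymm (G.acceptProb_le_pMax s t _) (ciSup_le fun I => ?_)
  rw [G.acceptProb_eq hst, G.acceptProb_eq hst]
  exact measureReal_mono fun g ⟨T, hT, _⟩ => ⟨T, hT, T.subset_univ⟩

/-- `p_max` is attained by inviting everybody, so it is the probability of a type-1
realization. -/
theorem SocialNetwork.pMax_eq (G : SocialNetwork V) {s t : V} (hst : ¬ G.graph.Adj s t) :
    G.pMax s t = G.realizationLaw.real {g | (G.trace s t g).isSome} := by
  rw [← G.covered_univ, ← G.acceptProb_eq hst, G.acceptProb_univ hst]

end Equivalence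

/-! ### The Chlamtáč algorithm -/

section Chlamtac

theorem argminOn_spec {β : Type*} {S : Finset β} (c : β → ℚ) (d : β) (h : S.Nonempty) :
    argminOn S c d ∈ S ∧ ∀ x ∈ S, c (argminOn S c d) ≤ c x := by
  rw [argminOn, dif_pos h]
  exact (S.exists_min_image c h).choose_spec

variable {V : Type*} [DecidableEq V]

theorem card_sup_add (S Q : Multiset (Finset V)) :
    (S + Q).sup.card = S.sup.card + newElements S Q := by
  rw [Multiset.sup_add, newElements, Finset.sup_eq_union, ← Finset.union_sdiff_self_eq_union,
    Finset.card_union_of_disjoint Finset.disjoint_sdiff]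

theorem newElements_le_card {S Q : Multiset (Finset V)} {J : Finset V}
    (h : ∀ T ∈ Q, T ⊆ J) : newElements S Q ≤ J.card :=
  Finset.card_le_card (Finset.sdiff_subset.trans (Multiset.sup_le.2 h))

theorem newElements_le_sum (S L : Multiset (Finset V)) :
    newElements S L ≤ (L.map fun T => newElements S {T}).sum := by
  induction L using Multiset.induction_on with
  | empty => simp [newElements]
  | cons T L ih =>
    rw [Multiset.map_cons, Multiset.sum_cons]
    refine le_trans ?_ (Nat.add_le_add_left ih _)
    simp only [newElements, Multiset.sup_cons, Multiset.sup_singleton, Finset.sup_eq_union,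
      Finset.union_sdiff_distrib]
    exact Finset.card_union_le _ _

theorem card_le_coverCount_sup {U S : Multiset (Finset V)} (h : S ≤ U) :
    S.card ≤ coverCount U S.sup := by
  refine le_trans (le_of_eq ?_) (Multiset.countP_le_of_le _ h)
  exact (Multiset.countP_eq_card.2 fun T hT => Multiset.le_sup hT).symm

/-- Whatever has been chosen so far, enough of the sets inside a feasible `J` remain. -/
theorem le_card_filter_subset {S R : Multiset (Finset V)} {p : ℕ} {J : Finset V}
    (hJ : p ≤ coverCount (S + R) J) : p ≤ S.card + (R.filter (· ⊆ J)).card := by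
  rw [coverCount, Multiset.countP_add, Multiset.countP_eq_card_filter _ R] at hJ
  exact hJ.trans (Nat.add_le_add_right (Multiset.countP_le_card _ _) _)

theorem leastExpanding_spec (S : Multiset (Finset V)) {R Q₀ : Multiset (Finset V)}
    (hQ₀ : Q₀ ≤ R) (h0 : Q₀ ≠ 0) :
    leastExpanding S R ≤ R ∧ 0 < (leastExpanding S R).card ∧
      (newElements S (leastExpanding S R) : ℚ) / ((leastExpanding S R).card : ℚ) ≤
        (newElements S Q₀ : ℚ) / (Q₀.card : ℚ) := by
  have hmem : Q₀ ∈ R.powerset.toFinset.filter (fun Q => Q ≠ 0) := by simp [hQ₀, h0]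
  obtain ⟨h1, h2⟩ := argminOn_spec
    (fun Q : Multiset (Finset V) => (newElements S Q : ℚ) / (Q.card : ℚ)) 0 ⟨Q₀, hmem⟩
  simp only [Finset.mem_filter, Multiset.mem_toFinset, Multiset.mem_powerset] at h1
  exact ⟨h1.1, Multiset.card_pos.2 h1.2, h2 Q₀ hmem⟩

/-- While more than `√m` sets are needed, the remaining sets inside a feasible `J` are more than
`√m` in number and add at most `|J|` elements, so a least expanding family costs at most
`|J| / √m` elements per set. -/
theorem newElements_leastExpanding_le {S R : Multiset (Finset V)} {p : ℕ} {J : Finset V} {a : ℝ}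
    (ha : 0 ≤ a) (hJ : p ≤ coverCount (S + R) J) (hp : a < (p : ℝ) - (S.card : ℝ)) :
    leastExpanding S R ≤ R ∧ 0 < (leastExpanding S R).card ∧
      (newElements S (leastExpanding S R) : ℝ) * a ≤ (leastExpanding S R).card * J.card := by
  set Q₀ := R.filter (· ⊆ J) with hQ₀
  have hcard : (p : ℝ) ≤ S.card + Q₀.card := by exact_mod_cast le_card_filter_subset hJ
  have haQ : a < Q₀.card := by linarith
  have h0 : Q₀ ≠ 0 := by
    intro h
    rw [h] at haQ
    simp only [Multiset.card_zero, Nat.cast_zero] at haQ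
    linarith
  obtain ⟨h1, h2, h3⟩ := leastExpanding_spec S (Multiset.filter_le (· ⊆ J) R) h0
  refine ⟨h1, h2, ?_⟩
  have hQ₀pos : 0 < Q₀.card := Multiset.card_pos.2 h0
  rw [div_le_div_iff₀ (by exact_mod_cast h2) (by exact_mod_cast hQ₀pos)] at h3
  have h3' : (newElements S (leastExpanding S R) : ℝ) * Q₀.card ≤
      newElements S Q₀ * (leastExpanding S R).card := by exact_mod_cast h3
  have h4 : (newElements S Q₀ : ℝ) ≤ J.card := by
    exact_mod_cast newElements_le_card fun T hT => (Multiset.mem_filter.1 hT).2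
  calc (newElements S (leastExpanding S R) : ℝ) * a
      ≤ newElements S (leastExpanding S R) * Q₀.card := by gcongr
    _ ≤ newElements S Q₀ * (leastExpanding S R).card := h3'
    _ ≤ J.card * (leastExpanding S R).card := by gcongr
    _ = _ := mul_comm _ _

/-- The invariant of the greedy phase: after `k` steps the union of the chosen family `S` has at
most `|S| |J| / √|U|` elements, and the phase is over or has chosen at least `k` sets. -/
theorem greedyStep_iterate {U : Multiset (Finset V)} {p : ℕ} {J : Finset V}
    (hJ : p ≤ coverCount U J) (k : ℕ) :
    let SR := (greedyStep U.card p)^[k] (0, U)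
    SR.1 + SR.2 = U ∧ (SR.1.sup.card : ℝ) * √(U.card : ℝ) ≤ SR.1.card * J.card ∧
      ((p : ℝ) - (SR.1.card : ℝ) ≤ √(U.card : ℝ) ∨ k ≤ SR.1.card) := by
  induction k with
  | zero => simp
  | succ k ih =>
    rw [Function.iterate_succ_apply']
    generalize (greedyStep U.card p)^[k] (0, U) = SR at ih ⊢
    obtain ⟨S, R⟩ := SR
    simp only at ih ⊢
    obtain ⟨h1, h2, h3⟩ := ih
    by_cases hc : √(U.card : ℝ) < (p : ℝ) - (S.card : ℝ)
    · obtain ⟨hQ1, hQ2, hQ3⟩ := newElements_leastExpanding_le (R := R) (J := J) (Real.sqrt_nonneg _)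
        (h1 ▸ hJ) hc
      rw [greedyStep, if_pos hc]
      refine ⟨?_, ?_, Or.inr ?_⟩
      · rw [add_assoc, add_tsub_cancel_of_le hQ1, h1]
      · rw [card_sup_add, Multiset.card_add]
        push_cast
        linarith
      · simp only [Multiset.card_add]
        have := h3.resolve_left (not_le.2 hc)
        omega
    · rw [greedyStep, if_neg hc]
      exact ⟨h1, h2, Or.inl (not_lt.1 hc)⟩

theorem isMSCApprox_chlamtac : IsMSCApprox (chlamtac (V := V)) := by
  intro U p hp
  obtain ⟨S, R, hSR⟩ : ∃ S R, (greedyStep U.card p)^[U.card] (0, U) = (S, R) := ⟨_, _, rfl⟩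
  obtain ⟨L, hL⟩ : ∃ L, L = argminOn (R.powersetCard (p - S.card)).toFinset
    (fun L => ((L.map (fun T => newElements S {T})).sum : ℚ)) 0 := ⟨_, rfl⟩
  have hout : chlamtac U p = (S + L).sup := by
    simp only [chlamtac, hSR, hL]
  have hcU : p ≤ coverCount U U.sup := hp.trans (card_le_coverCount_sup le_rfl)
  have hmain : ∀ J : Finset V, p ≤ coverCount U J → S + R = U ∧ L ≤ R ∧
      L.card = p - S.card ∧ (((S + L).sup.card : ℝ) ≤ 2 * √(U.card : ℝ) * J.card) := by
    intro J hJ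
    have hinv := greedyStep_iterate hJ U.card
    simp only [hSR] at hinv
    obtain ⟨h1, h2, h3⟩ := hinv
    have hSU : S.card ≤ U.card := by rw [← h1, Multiset.card_add]; omega
    have hrem : ((p - S.card : ℕ) : ℝ) ≤ √(U.card : ℝ) := by
      rcases h3 with h3 | h3
      · rcases le_total p S.card with h | h
        · simp [Nat.sub_eq_zero_of_le h]
        · rwa [Nat.cast_sub h]
      · simp [Nat.sub_eq_zero_of_le (hp.trans h3)]
    have hQ₀ := le_card_filter_subset (R := R) (S := S) (J := J) (h1 ▸ hJ)
    -- A competitor for the last batch: enough remaining sets inside `J`.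
    obtain ⟨Q, hQ⟩ : ∃ Q, Q ∈ (R.filter (· ⊆ J)).powersetCard (p - S.card) := by
      apply Multiset.card_pos_iff_exists_mem.1
      rw [Multiset.card_powersetCard]
      exact Nat.choose_pos (by omega)
    obtain ⟨hQle, hQcard⟩ := Multiset.mem_powersetCard.1 hQ
    have hQmem : Q ∈ (R.powersetCard (p - S.card)).toFinset :=
      Multiset.mem_toFinset.2 (Multiset.mem_powersetCard.2
        ⟨hQle.trans (Multiset.filter_le _ _), hQcard⟩)
    obtain ⟨hL1, hL2⟩ := argminOn_spec
      (fun L : Multiset (Finset V) => ((L.map (fun T => newElements S {T})).sum : ℚ)) 0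
      ⟨Q, hQmem⟩
    rw [← hL] at hL1 hL2
    obtain ⟨hLR, hLcard⟩ := Multiset.mem_powersetCard.1 (Multiset.mem_toFinset.1 hL1)
    have hLQ : (L.map (fun T => newElements S {T})).sum ≤
        (Q.map (fun T => newElements S {T})).sum := by
      have := hL2 Q hQmem
      exact_mod_cast this
    have hQsum : (Q.map (fun T => newElements S {T})).sum ≤ Q.card * J.card := by
      have := Multiset.sum_le_card_nsmul (Q.map (fun T => newElements S {T})) J.card ?_
      · simpa using this
      · intro x hx
        obtain ⟨T, hT, rfl⟩ := Multiset.mem_map.1 hx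
        refine newElements_le_card fun T' hT' => ?_
        rw [Multiset.mem_singleton.1 hT']
        exact (Multiset.mem_filter.1 (Multiset.mem_of_le hQle hT)).2
    have hnew : (newElements S L : ℝ) ≤ √(U.card : ℝ) * J.card := by
      calc (newElements S L : ℝ) ≤ ((Q.card * J.card : ℕ) : ℝ) := by
            exact_mod_cast (newElements_le_sum S L).trans (hLQ.trans hQsum)
        _ = ((p - S.card : ℕ) : ℝ) * J.card := by rw [hQcard]; push_cast; ring
        _ ≤ _ := by gcongr
    have hsup : (S.sup.card : ℝ) ≤ √(U.card : ℝ) * J.card := by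
      rcases Nat.eq_zero_or_pos U.card with h0 | h0
      · have : S = 0 := Multiset.card_eq_zero.1 (by omega)
        subst this
        simp only [Multiset.sup_zero, Finset.bot_eq_empty, Finset.card_empty, Nat.cast_zero]
        positivity
      · have hpos : 0 < √(U.card : ℝ) := Real.sqrt_pos.2 (by exact_mod_cast h0)
        refine le_of_mul_le_mul_right (h2.trans ?_) hpos
        calc (S.card : ℝ) * J.card ≤ U.card * J.card := by gcongr
          _ = (√(U.card : ℝ) * √(U.card : ℝ)) * J.card := by
            rw [Real.mul_self_sqrt (Nat.cast_nonneg _)]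
          _ = _ := by ring
    refine ⟨h1, hLR, hLcard, ?_⟩
    rw [card_sup_add]
    push_cast
    linarith
  rw [hout]
  refine ⟨?_, fun J hJ => (hmain J hJ).2.2.2⟩
  obtain ⟨h1, hLR, hLcard, -⟩ := hmain U.sup hcU
  have hle : S + L ≤ U := by rw [← h1]; gcongr
  refine le_trans ?_ (card_le_coverCount_sup hle)
  rw [Multiset.card_add]
  omega

end Chlamtac

/-! ### The parameters -/

section Parameters

/-- With `x = ε₁ (1 + ε₀)`, the condition is an equation in `x` alone, whose left-hand side passes
from `α` to `-α` as `x` runs from `0` to `α`. -/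
theorem exists_admissible {α ε : ℝ} (hα : α ≤ 1) (hε : 0 < ε) (hεα : ε < α) :
    ∃ ε₀ ε₁ : ℝ, Admissible α ε ε₀ ε₁ := by
  have hα0 : 0 < α := hε.trans hεα
  have hcont : ContinuousOn (fun x : ℝ => (α - x) / (1 + x) * (1 - x) - x) (Set.Icc 0 α) := by
    refine ContinuousOn.sub (ContinuousOn.mul (ContinuousOn.div (by fun_prop) (by fun_prop) ?_)
      (by fun_prop)) (by fun_prop)
    intro x hx
    linarith [hx.1]
  obtain ⟨x, ⟨hx0, hxα⟩, hx⟩ := intermediate_value_Icc' hα0.le hcont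
    (show α - ε ∈ Set.Icc _ _ by constructor <;> simp <;> linarith)
  simp only at hx
  have hx0' : 0 < x := lt_of_le_of_ne hx0 (by rintro rfl; simp at hx; linarith)
  have hxα' : x < α := lt_of_le_of_ne hxα (by rintro rfl; simp at hx; linarith)
  have hmul : x / (3 / 2) * (1 + 1 / 2) = x := by ring
  refine ⟨1 / 2, x / (3 / 2), by norm_num, by norm_num, by positivity, ?_, ?_, ?_⟩
  · rw [div_lt_one (by norm_num)]; linarith
  · rw [betaParam, hmul]
    exact div_pos (by linarith) (by linarith)
  · rw [betaParam, hmul, hx]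

end Parameters

/-! ### Chernoff bounds for independent samples -/

section Chernoff

open ProbabilityTheory Real

variable {Ω : Type*}

open Classical in
/-- The number of the first `M` entries of the stream `g` that lie in `S`. -/
noncomputable def hits (S : Set Ω) (g : ℕ → Ω) (M : ℕ) : ℕ :=
  ((Finset.range M).filter (fun k => g k ∈ S)).card

theorem hits_eq_sum (S : Set Ω) (g : ℕ → Ω) (M : ℕ) :
    (hits S g M : ℝ) = ∑ k ∈ Finset.range M, S.indicator (fun _ => (1 : ℝ)) (g k) := by
  classical
  simp [hits, Set.indicator_apply]

theorem hits_mono (S : Set Ω) (g : ℕ → Ω) : Monotone (hits S g) := by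
  classical
  exact fun _ _ h =>
    Finset.card_le_card (Finset.filter_subset_filter _ (Finset.range_subset_range.2 h))

theorem hits_succ (S : Set Ω) [DecidablePred (· ∈ S)] (g : ℕ → Ω) (M : ℕ) :
    hits S g (M + 1) = hits S g M + if g M ∈ S then 1 else 0 := by
  rw [hits, hits, Finset.range_add_one, Finset.filter_insert]
  split_ifs with h
  · rw [Finset.card_insert_of_notMem (by simp)]
  · rfl

variable [MeasurableSpace Ω] [DiscreteMeasurableSpace Ω] (P : Measure Ω) [IsProbabilityMeasure P]

theorem measurable_hits (S : Set Ω) (M : ℕ) :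
    Measurable (fun g : ℕ → Ω => (hits S g M : ℝ)) := by
  simp only [hits_eq_sum]
  exact Finset.measurable_sum _ fun k _ =>
    (Measurable.of_discrete (f := S.indicator fun _ => (1 : ℝ))).comp (measurable_pi_apply k)

theorem mgf_indicator (S : Set Ω) (r : ℝ) :
    mgf (S.indicator fun _ => (1 : ℝ)) P r = 1 + P.real S * (exp r - 1) := by
  have hS : MeasurableSet S := MeasurableSet.of_discrete
  have h : ∀ x, exp (r * S.indicator (fun _ => (1 : ℝ)) x) =
      1 + S.indicator (fun _ => exp r - 1) x := by
    intro x
    by_cases hx : x ∈ S <;> simp [hx]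
  simp only [mgf, h]
  rw [integral_add (integrable_const _) ((integrable_const _).indicator hS),
    integral_indicator_const _ hS]
  simp

theorem mgf_hits_le (S : Set Ω) (M : ℕ) (r : ℝ) :
    mgf (fun g : ℕ → Ω => (hits S g M : ℝ)) (Measure.infinitePi fun _ : ℕ => P) r ≤
      exp (M * P.real S * (exp r - 1)) := by
  have hind : iIndepFun (fun (k : ℕ) (g : ℕ → Ω) => S.indicator (fun _ => (1 : ℝ)) (g k))
      (Measure.infinitePi fun _ : ℕ => P) :=
    iIndepFun_infinitePi fun _ => Measurable.of_discrete
  have hmgf : ∀ k : ℕ, mgf (fun g : ℕ → Ω => S.indicator (fun _ => (1 : ℝ)) (g k))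
      (Measure.infinitePi fun _ : ℕ => P) r = 1 + P.real S * (exp r - 1) := by
    intro k
    rw [← mgf_indicator P S r]
    have hmp := measurePreserving_eval_infinitePi (fun _ : ℕ => P) k
    have := mgf_map (μ := Measure.infinitePi fun _ : ℕ => P) (t := r)
      (X := S.indicator fun _ => (1 : ℝ)) (Y := Function.eval k)
      hmp.measurable.aemeasurable Measurable.of_discrete.aestronglyMeasurable
    rw [hmp.map_eq] at this
    rw [this]
    rfl
  have hsum : (fun g : ℕ → Ω => (hits S g M : ℝ)) =
      ∑ k ∈ Finset.range M, fun g : ℕ → Ω => S.indicator (fun _ => (1 : ℝ)) (g k) := by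
    funext g
    rw [hits_eq_sum, Finset.sum_apply]
  rw [hsum, hind.mgf_sum fun k =>
    (Measurable.of_discrete (f := S.indicator fun _ => (1 : ℝ))).comp (measurable_pi_apply k)]
  simp only [hmgf, Finset.prod_const, Finset.card_range]
  have h0 : 0 ≤ 1 + P.real S * (exp r - 1) := by
    rw [← mgf_indicator P S r]
    exact mgf_nonneg
  calc (1 + P.real S * (exp r - 1)) ^ M ≤ exp (P.real S * (exp r - 1)) ^ M := by
        gcongr
        linarith [add_one_le_exp (P.real S * (exp r - 1))]
    _ = _ := by rw [← exp_nat_mul]; ring_nf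

theorem integrable_exp_hits (S : Set Ω) (M : ℕ) (r : ℝ) :
    Integrable (fun g : ℕ → Ω => exp (r * (hits S g M : ℝ)))
      (Measure.infinitePi fun _ : ℕ => P) := by
  refine Integrable.of_bound
    ((measurable_hits S M).const_mul r).exp.aestronglyMeasurable (exp (|r| * M))
    (Filter.Eventually.of_forall fun g => ?_)
  rw [norm_of_nonneg (exp_pos _).le, exp_le_exp]
  have hM : (hits S g M : ℝ) ≤ M := by
    rw [hits_eq_sum]
    refine (Finset.sum_le_card_nsmul _ _ 1 fun k _ => ?_).trans (by simp)
    exact Set.indicator_le_self' (fun _ _ => zero_le_one) _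
  calc r * (hits S g M : ℝ) ≤ |r| * (hits S g M : ℝ) := by gcongr; exact le_abs_self r
    _ ≤ |r| * M := by gcongr

theorem measureReal_le_hits (S : Set Ω) (M : ℕ) {r : ℝ} (hr : 0 ≤ r) (a : ℝ) :
    (Measure.infinitePi fun _ : ℕ => P).real {g | a ≤ (hits S g M : ℝ)} ≤
      exp (-r * a + M * P.real S * (exp r - 1)) := by
  refine (measure_ge_le_exp_mul_mgf a hr (integrable_exp_hits P S M r)).trans ?_
  rw [exp_add]
  gcongr
  exact mgf_hits_le P S M r

theorem measureReal_hits_le (S : Set Ω) (M : ℕ) {r : ℝ} (hr : 0 ≤ r) (a : ℝ) :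
    (Measure.infinitePi fun _ : ℕ => P).real {g | (hits S g M : ℝ) ≤ a} ≤
      exp (r * a + M * P.real S * (exp (-r) - 1)) := by
  refine (measure_le_le_exp_mul_mgf a (neg_nonpos.2 hr) (integrable_exp_hits P S M (-r))).trans ?_
  rw [exp_add, neg_neg]
  gcongr
  exact mgf_hits_le P S M (-r)

theorem exp_neg_le_quadratic {r : ℝ} (hr : 0 ≤ r) : exp (-r) ≤ 1 - r + r ^ 2 / 2 := by
  have h1 := quadratic_le_exp_of_nonneg hr
  have h2 : 0 < 1 - r + r ^ 2 / 2 := by nlinarith [sq_nonneg (r - 1)]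
  rw [exp_neg, inv_le_comm₀ (exp_pos r) h2]
  refine le_trans ?_ h1
  rw [inv_le_iff_one_le_mul₀ h2]
  nlinarith [sq_nonneg (r ^ 2)]

/-- The constant `e - 2` is not optimal here, but it is the one of the stopping rule. -/
theorem exp_le_of_le_seven_tenths {r : ℝ} (h0 : 0 ≤ r) (h1 : r ≤ 7 / 10) :
    exp r ≤ 1 + r + (exp 1 - 2) * r ^ 2 := by
  have h := exp_bound' h0 (by linarith) (n := 3) (by norm_num)
  simp only [Finset.sum_range_succ, Finset.sum_range_zero, Nat.factorial] at h
  norm_num at h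
  have he := exp_one_gt_d9
  have hr2 : 0 ≤ r ^ 2 := sq_nonneg r
  have h3 : r ^ 3 ≤ 7 / 10 * r ^ 2 := by nlinarith
  nlinarith

/-- The two-sided deviation bound that governs the sample size `l`: an event of probability at most
`q` has a frequency off by more than `x q` with probability at most
`2 exp (- l q x² / (2 + x))`. -/
theorem measureReal_deviation_le (S : Set Ω) (l : ℕ) {x q : ℝ} (hx : 0 ≤ x) (hS : P.real S ≤ q) :
    (Measure.infinitePi fun _ : ℕ => P).real
        {g | ¬ |(hits S g l : ℝ) - l * P.real S| ≤ l * (x * q)} ≤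
      2 * exp (-(l * q * (x ^ 2 / (2 + x)))) := by
  have hp0 : 0 ≤ P.real S := measureReal_nonneg
  have hq0 : 0 ≤ q := hp0.trans hS
  have hx1 : 0 < 1 + x := by linarith
  have hx2 : 0 < 2 + x := by linarith
  have hup : (Measure.infinitePi fun _ : ℕ => P).real
      {g | l * P.real S + l * (x * q) ≤ (hits S g l : ℝ)} ≤
        exp (-(l * q * (x ^ 2 / (2 + x)))) := by
    refine (measureReal_le_hits P S l (log_nonneg (by linarith : 1 ≤ 1 + x)) _).trans ?_
    rw [exp_le_exp, exp_log hx1]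
    have hlog := le_log_one_add_of_nonneg hx
    have hlog' : log (1 + x) ≤ x := by linarith [log_le_sub_one_of_pos hx1]
    have h1 : x - (1 + x) * log (1 + x) ≤ -(x ^ 2 / (2 + x)) := by
      have : (1 + x) * (2 * x / (x + 2)) ≤ (1 + x) * log (1 + x) := by gcongr
      have h2 : (1 + x) * (2 * x / (x + 2)) = x + x ^ 2 / (2 + x) := by field_simp; ring
      linarith
    have h2 : P.real S * (x - log (1 + x)) ≤ q * (x - log (1 + x)) :=
      mul_le_mul_of_nonneg_right hS (by linarith)
    calc -log (1 + x) * (l * P.real S + l * (x * q)) + l * P.real S * (1 + x - 1)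
        = l * (P.real S * (x - log (1 + x)) - x * q * log (1 + x)) := by ring
      _ ≤ l * (q * (x - log (1 + x)) - x * q * log (1 + x)) := by gcongr
      _ = l * (q * (x - (1 + x) * log (1 + x))) := by ring
      _ ≤ l * (q * (-(x ^ 2 / (2 + x)))) := by gcongr
      _ = _ := by ring
  have hdown : (Measure.infinitePi fun _ : ℕ => P).real
      {g | (hits S g l : ℝ) ≤ l * P.real S - l * (x * q)} ≤
        exp (-(l * q * (x ^ 2 / (2 + x)))) := by
    refine (measureReal_hits_le P S l hx _).trans ?_
    rw [exp_le_exp]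
    have h1 := exp_neg_le_quadratic hx
    have h2 : x ^ 2 / (2 + x) ≤ x ^ 2 / 2 := by gcongr; linarith
    calc x * (l * P.real S - l * (x * q)) + l * P.real S * (exp (-x) - 1)
        = l * (P.real S * (exp (-x) - 1 + x) - x ^ 2 * q) := by ring
      _ ≤ l * (P.real S * (x ^ 2 / 2) - x ^ 2 * q) := by gcongr; linarith
      _ ≤ l * (q * (x ^ 2 / 2) - x ^ 2 * q) := by gcongr
      _ = -(l * q * (x ^ 2 / 2)) := by ring
      _ ≤ _ := by gcongr
  refine (measureReal_mono (s₂ := {g | l * P.real S + l * (x * q) ≤ (hits S g l : ℝ)} ∪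
      {g | (hits S g l : ℝ) ≤ l * P.real S - l * (x * q)}) ?_).trans
    ((measureReal_union_le _ _).trans (by linarith))
  intro g hg
  by_contra hcon
  simp only [Set.mem_union, Set.mem_ofPred_eq, not_or, not_le] at hcon
  exact hg (abs_le.2 ⟨by linarith [hcon.2], by linarith [hcon.1]⟩)

end Chernoff

/-! ### The stopping rule -/

section StoppingRule

open Real

variable {Ω : Type*}

/-- The number of entries in `S` exceeds `a` for the first time after `i` draws. -/
def IsStop (S : Set Ω) (a : ℝ) (g : ℕ → Ω) (i : ℕ) : Prop :=
  a < (hits S g i : ℝ) ∧ ∀ j < i, (hits S g j : ℝ) ≤ a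

theorem IsStop.unique {S : Set Ω} {a : ℝ} {g : ℕ → Ω} {i j : ℕ} (hi : IsStop S a g i)
    (hj : IsStop S a g j) : i = j := by
  rcases lt_trichotomy i j with h | h | h
  · exact absurd hi.1 (not_lt.2 (hj.2 i h))
  · exact h
  · exact absurd hj.1 (not_lt.2 (hi.2 j h))

variable [MeasurableSpace Ω] [DiscreteMeasurableSpace Ω] (P : Measure Ω)
  [IsProbabilityMeasure P]

theorem one_le_upsilon {ε₀ N : ℝ} (h0 : 0 < ε₀) (hN : 2 < N) : 1 ≤ upsilon ε₀ N := by
  have he := exp_one_gt_d9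
  have hL : 0 ≤ log (2 * N) := log_nonneg (by linarith)
  have : 0 ≤ 4 * (exp 1 - 2) * (1 + ε₀) * log (2 * N) / ε₀ ^ 2 := by
    have : 0 ≤ exp 1 - 2 := by linarith
    positivity
  rw [upsilon]
  linarith

/-- An overestimate of the mean is unlikely: the threshold is not exceeded within `M` draws if `M`
times the mean is at most `upsilon ε₀ N / (1 + ε₀)`. -/
theorem measureReal_upsilon_lt_hits_le (S : Set Ω) {ε₀ N : ℝ} (h0 : 0 < ε₀) (h1 : ε₀ < 1)
    (hN : 2 < N) {M : ℕ} (hM : M * P.real S ≤ upsilon ε₀ N / (1 + ε₀)) :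
    (Measure.infinitePi fun _ : ℕ => P).real {g | upsilon ε₀ N < (hits S g M : ℝ)} ≤
      1 / (2 * N) := by
  have he := exp_one_gt_d9
  have hc : 0 < exp 1 - 2 := by linarith
  -- The exponent is minimal at `r = ε₀ / (2 (e - 2))`.
  set r := ε₀ / (2 * (exp 1 - 2)) with hr
  have hr0 : 0 ≤ r := by positivity
  have hr1 : r ≤ 7 / 10 := by
    rw [hr, div_le_iff₀ (by positivity)]
    linarith
  refine (measureReal_mono (s₂ := {g | upsilon ε₀ N ≤ (hits S g M : ℝ)})
    fun g hg => (show upsilon ε₀ N < (hits S g M : ℝ) from hg).le).trans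
      ((measureReal_le_hits P S M hr0 (upsilon ε₀ N)).trans ?_)
  rw [one_div, ← exp_log (show (0 : ℝ) < 2 * N by linarith), ← exp_neg, exp_le_exp]
  set μ := upsilon ε₀ N / (1 + ε₀) with hμ
  have hups : upsilon ε₀ N = (1 + ε₀) * μ := by rw [hμ]; field_simp
  have hμL : 4 * (exp 1 - 2) * log (2 * N) / ε₀ ^ 2 ≤ μ := by
    rw [hμ, le_div_iff₀ (by linarith), upsilon]
    have : 4 * (exp 1 - 2) * log (2 * N) / ε₀ ^ 2 * (1 + ε₀) =
      4 * (exp 1 - 2) * (1 + ε₀) * log (2 * N) / ε₀ ^ 2 := by ring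
    linarith
  have hexp := exp_le_of_le_seven_tenths hr0 hr1
  have hexp0 : 0 ≤ exp r - 1 := by linarith [add_one_le_exp r]
  have hμ0 : 0 ≤ μ := le_trans (by positivity) hM
  calc -r * upsilon ε₀ N + M * P.real S * (exp r - 1)
      ≤ -r * upsilon ε₀ N + μ * (exp r - 1) := by gcongr
    _ ≤ -r * ((1 + ε₀) * μ) + μ * (r + (exp 1 - 2) * r ^ 2) := by
        rw [hups]; gcongr; linarith
    _ = -(μ * (ε₀ ^ 2 / (4 * (exp 1 - 2)))) := by rw [hr]; field_simp; ring
    _ ≤ -(4 * (exp 1 - 2) * log (2 * N) / ε₀ ^ 2 * (ε₀ ^ 2 / (4 * (exp 1 - 2)))) := by gcongr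
    _ = -log (2 * N) := by field_simp

/-- An underestimate of the mean is unlikely: the threshold is exceeded within `M` draws if `M + 1`
times the mean is at least `upsilon ε₀ N / (1 - ε₀)`. -/
theorem measureReal_hits_le_upsilon_le (S : Set Ω) {ε₀ N : ℝ} (h0 : 0 < ε₀) (h1 : ε₀ < 1)
    (hN : 2 < N) {M : ℕ} (hM : upsilon ε₀ N / (1 - ε₀) ≤ (M + 1) * P.real S) :
    (Measure.infinitePi fun _ : ℕ => P).real {g | (hits S g M : ℝ) ≤ upsilon ε₀ N} ≤
      1 / (2 * N) := by
  have he := exp_one_gt_d9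
  refine (measureReal_hits_le P S M h0.le (upsilon ε₀ N)).trans ?_
  rw [one_div, ← exp_log (show (0 : ℝ) < 2 * N by linarith), ← exp_neg, exp_le_exp]
  set L := log (2 * N) with hL
  have hL1 : 1 ≤ L := by
    rw [hL, le_log_iff_exp_le (by linarith)]
    linarith [exp_one_lt_d9]
  set m := (M : ℝ) * P.real S with hm
  have hm0 : 0 ≤ m := by positivity
  have hp1 : P.real S ≤ 1 := measureReal_le_one
  have hups : upsilon ε₀ N ≤ (1 - ε₀) * (m + 1) := by
    rw [div_le_iff₀ (by linarith)] at hM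
    refine hM.trans ?_
    rw [mul_comm]
    have : (M + 1) * P.real S ≤ m + 1 := by rw [hm]; linarith
    exact mul_le_mul_of_nonneg_left this (by linarith)
  -- The additive error `ε₀ (1 - ε₀) ≤ 1 / 4` from rounding `M` is absorbed by `4 (e - 2) > 2`.
  have hmain : (L + ε₀ * (1 - ε₀)) ≤ m * (ε₀ ^ 2 / 2) := by
    have hup2 : upsilon ε₀ N * ε₀ ^ 2 = ε₀ ^ 2 + 4 * (exp 1 - 2) * (1 + ε₀) * L := by
      rw [upsilon, ← hL]; field_simp
    have h2 : ε₀ ^ 2 + 4 * (exp 1 - 2) * (1 + ε₀) * L ≤ (1 - ε₀) * (m + 1) * ε₀ ^ 2 := by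
      rw [← hup2]; gcongr
    have h3 : 14 / 5 * L ≤ 4 * (exp 1 - 2) * (1 + ε₀) * L := by
      have : 14 / 5 ≤ 4 * (exp 1 - 2) * (1 + ε₀) := by nlinarith
      gcongr
    have h4 : (1 - ε₀) * (m + 1) * ε₀ ^ 2 ≤ m * ε₀ ^ 2 + ε₀ ^ 2 := by
      have : (1 - ε₀) * (m + 1) ≤ m + 1 := by nlinarith
      nlinarith [mul_le_mul_of_nonneg_right this (sq_nonneg ε₀)]
    nlinarith [sq_nonneg (ε₀ - 1 / 2)]
  have hexp := exp_neg_le_quadratic h0.le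
  calc ε₀ * upsilon ε₀ N + m * (exp (-ε₀) - 1)
      ≤ ε₀ * ((1 - ε₀) * (m + 1)) + m * (-ε₀ + ε₀ ^ 2 / 2) := by gcongr; linarith
    _ = ε₀ * (1 - ε₀) - m * (ε₀ ^ 2 / 2) := by ring
    _ ≤ -L := by linarith

theorem measurableSet_isStop (S : Set Ω) (a : ℝ) (i : ℕ) :
    MeasurableSet {g : ℕ → Ω | IsStop S a g i} := by
  have : {g : ℕ → Ω | IsStop S a g i} = {g | a < (hits S g i : ℝ)} ∩
      ⋂ j, ⋂ (_ : j < i), {g | (hits S g j : ℝ) ≤ a} := by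
    ext g
    simp [IsStop]
  rw [this]
  exact (measurableSet_lt measurable_const (measurable_hits S i)).inter
    (MeasurableSet.iInter fun j => MeasurableSet.iInter fun _ =>
      measurableSet_le (measurable_hits S j) measurable_const)

/-- The stopping rule terminates with a `(1 ± ε₀)`-estimate of the mean with probability at least
`1 - 1 / N`. -/
theorem measureReal_not_estimate_le (S : Set Ω) (hS : 0 < P.real S) {ε₀ N : ℝ} (h0 : 0 < ε₀)
    (h1 : ε₀ < 1) (hN : 2 < N) :
    (Measure.infinitePi fun _ : ℕ => P).real {g | ¬ ∃ i, IsStop S (upsilon ε₀ N) g i ∧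
      (1 - ε₀) * P.real S ≤ upsilon ε₀ N / i ∧ upsilon ε₀ N / i ≤ (1 + ε₀) * P.real S} ≤
      1 / N := by
  have hU : 0 < upsilon ε₀ N := zero_lt_one.trans_le (one_le_upsilon h0 hN)
  have hε1 : 0 < 1 - ε₀ := by linarith
  set p := P.real S with hp
  set y := upsilon ε₀ N / ((1 + ε₀) * p) with hy
  set x := upsilon ε₀ N / ((1 - ε₀) * p) with hx
  have hy0 : 0 < y := by positivity
  have hx0 : 0 < x := by positivity
  have hceil : ((⌈y⌉₊ - 1 : ℕ) : ℝ) < y := Nat.lt_ceil.1 (by have := Nat.ceil_pos.2 hy0; omega)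
  have hM1 : ((⌈y⌉₊ - 1 : ℕ) : ℝ) * p ≤ upsilon ε₀ N / (1 + ε₀) := by
    calc ((⌈y⌉₊ - 1 : ℕ) : ℝ) * p ≤ y * p := by gcongr
      _ = _ := by rw [hy]; field_simp
  have hM2 : upsilon ε₀ N / (1 - ε₀) ≤ (⌊x⌋₊ + 1) * p := by
    calc upsilon ε₀ N / (1 - ε₀) = x * p := by rw [hx]; field_simp
      _ ≤ _ := by gcongr; exact (Nat.lt_floor_add_one x).le
  have hA := measureReal_upsilon_lt_hits_le P S h0 h1 hN hM1
  have hB := measureReal_hits_le_upsilon_le P S h0 h1 hN hM2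
  refine (measureReal_mono (s₂ := {g | upsilon ε₀ N < (hits S g (⌈y⌉₊ - 1) : ℝ)} ∪
      {g | (hits S g ⌊x⌋₊ : ℝ) ≤ upsilon ε₀ N}) ?_).trans
    ((measureReal_union_le _ _).trans ((add_le_add hA hB).trans_eq (by field_simp; norm_num)))
  intro g hg
  by_contra hcon
  simp only [Set.mem_union, Set.mem_ofPred_eq, not_or, not_le, not_lt] at hcon
  obtain ⟨hc1, hc2⟩ := hcon
  refine hg ?_
  classical
  have hex : ∃ i, upsilon ε₀ N < (hits S g i : ℝ) := ⟨_, hc2⟩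
  have hfloor : Nat.find hex ≤ ⌊x⌋₊ := Nat.find_min' hex hc2
  have hlow : ⌈y⌉₊ ≤ Nat.find hex := by
    by_contra hlt
    have h2 : (hits S g (Nat.find hex) : ℝ) ≤ hits S g (⌈y⌉₊ - 1) := by
      exact_mod_cast hits_mono S g (by omega)
    linarith [Nat.find_spec hex]
  have hyi : y ≤ (Nat.find hex : ℝ) := (Nat.le_ceil y).trans (by exact_mod_cast hlow)
  have hix : (Nat.find hex : ℝ) ≤ x := (Nat.le_floor_iff hx0.le).1 hfloor
  have hi0 : (0 : ℝ) < Nat.find hex := hy0.trans_le hyi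
  refine ⟨Nat.find hex, ⟨Nat.find_spec hex, fun j hj => not_lt.1 (Nat.find_min hex hj)⟩, ?_, ?_⟩
  · rw [le_div_iff₀ hi0]
    rw [hx, le_div_iff₀ (by positivity)] at hix
    linarith
  · rw [div_le_iff₀ hi0]
    rw [hy, div_le_iff₀ (by positivity)] at hyi
    linarith

end StoppingRule

/-! ### Two independent sources of randomness -/

section Independence

/-- If the first component selects one of countably many disjoint cases `E i`, and in each case
the second component fails with probability at most `δ`, then the total failure probability is at
most `δ`. -/
theorem prod_real_exists_le {X Y : Type*} [MeasurableSpace X] [MeasurableSpace Y] (μ : Measure X)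
    (ν : Measure Y) [IsProbabilityMeasure μ] [IsProbabilityMeasure ν] {E : ℕ → Set X}
    {B : ℕ → Set Y} (hE : ∀ i, MeasurableSet (E i))
    (hdisj : Pairwise fun i j => Disjoint (E i) (E j))
    {δ : ℝ} (hδ : 0 ≤ δ) (hB : ∀ i, ν.real (B i) ≤ δ) :
    (μ.prod ν).real {ω | ∃ i, ω.1 ∈ E i ∧ ω.2 ∈ B i} ≤ δ := by
  have hset : {ω : X × Y | ∃ i, ω.1 ∈ E i ∧ ω.2 ∈ B i} = ⋃ i, E i ×ˢ B i := by
    ext ω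
    simp
  have hB' : ∀ i, ν (B i) ≤ ENNReal.ofReal δ := fun i =>
    (ENNReal.le_ofReal_iff_toReal_le (measure_ne_top _ _) hδ).2 (hB i)
  refine ENNReal.toReal_le_of_le_ofReal hδ ?_
  calc (μ.prod ν) {ω | ∃ i, ω.1 ∈ E i ∧ ω.2 ∈ B i}
      ≤ ∑' i, (μ.prod ν) (E i ×ˢ B i) := by rw [hset]; exact measure_iUnion_le _
    _ = ∑' i, μ (E i) * ν (B i) := by simp only [Measure.prod_prod]
    _ ≤ ∑' i, μ (E i) * ENNReal.ofReal δ := by gcongr with i; exact hB' i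
    _ = μ (⋃ i, E i) * ENNReal.ofReal δ := by
        rw [ENNReal.tsum_mul_right, measure_iUnion hdisj hE]
    _ ≤ 1 * ENNReal.ofReal δ := by gcongr; exact prob_le_one
    _ = _ := one_mul _

end Independence

/-! ### The sampling framework -/

section Framework

variable {V : Type*} [Fintype V] [DecidableEq V]

theorem SocialNetwork.coverCount_typeOneFamily (G : SocialNetwork V) (s t : V)
    (g : ℕ → V → Option V) (l : ℕ) (I : Finset V) :
    coverCount (G.typeOneFamily s t g l) I = hits {g | G.Covered s t I g} g l := by
  classical
  induction l with
  | zero => simp [coverCount, SocialNetwork.typeOneFamily, hits]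
  | succ l ih =>
    rcases h : G.trace s t (g l) with _ | T
    · have hn : g l ∉ {g | G.Covered s t I g} := by simp [SocialNetwork.Covered, h]
      have hcons : G.typeOneFamily s t g (l + 1) = G.typeOneFamily s t g l := by
        rw [SocialNetwork.typeOneFamily, Multiset.range_succ]
        exact Multiset.filterMap_cons_none (f := fun k => G.trace s t (g k)) l _ h
      rw [hits_succ, if_neg hn, hcons, ih, add_zero]
    · have hiff : g l ∈ {g | G.Covered s t I g} ↔ T ⊆ I := by simp [SocialNetwork.Covered, h]
      have hcons : G.typeOneFamily s t g (l + 1) = T ::ₘ G.typeOneFamily s t g l := by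
        rw [SocialNetwork.typeOneFamily, Multiset.range_succ]
        exact Multiset.filterMap_cons_some (fun k => G.trace s t (g k)) l _ h
      rw [hits_succ, hcons, ← ih, coverCount, coverCount, Multiset.countP_cons]
      by_cases hT : T ⊆ I
      · rw [if_pos hT, if_pos (hiff.2 hT)]
      · rw [if_neg hT, if_neg fun hmem => hT (hiff.1 hmem)]

theorem SocialNetwork.card_typeOneFamily (G : SocialNetwork V) (s t : V)
    (g : ℕ → V → Option V) (l : ℕ) :
    (G.typeOneFamily s t g l).card = coverCount (G.typeOneFamily s t g l) Finset.univ := by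
  rw [coverCount, eq_comm, Multiset.countP_eq_card]
  exact fun T _ => T.subset_univ

theorem SocialNetwork.typeOneCount_eq_hits (G : SocialNetwork V) (s t : V)
    (g : ℕ → V → Option V) (i : ℕ) :
    G.typeOneCount s t g i = hits {g | (G.trace s t g).isSome} g i := by
  rw [SocialNetwork.typeOneCount, hits]
  congr

theorem SocialNetwork.estimate_eq_some (G : SocialNetwork V) {s t : V} {ε₀ N : ℝ}
    {g : ℕ → V → Option V} {i : ℕ}
    (h : IsStop {g | (G.trace s t g).isSome} (upsilon ε₀ N) g i) :
    G.estimate s t ε₀ N g = some (upsilon ε₀ N / i) := by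
  classical
  have hex : ∃ i, upsilon ε₀ N < (G.typeOneCount s t g i : ℝ) :=
    ⟨i, by rw [G.typeOneCount_eq_hits]; exact h.1⟩
  have hfind : Nat.find hex = i := by
    rw [Nat.find_eq_iff]
    refine ⟨by rw [G.typeOneCount_eq_hits]; exact h.1, fun j hj => ?_⟩
    rw [G.typeOneCount_eq_hits, not_lt]
    exact h.2 j hj
  rw [SocialNetwork.estimate, dif_pos hex, ← hfind]

/-- All `2 ^ n` invitation sets have an empirical acceptance rate within `x p_max` of their
acceptance probability, except with probability `1 / N`. -/
theorem SocialNetwork.measureReal_not_uniform_le (G : SocialNetwork V) {s t : V}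
    (hst : ¬ G.graph.Adj s t) {x N : ℝ} (hx : 0 ≤ x) (hN : 0 < N) {l : ℕ}
    (hl : Real.log 2 + Real.log N + Fintype.card V * Real.log 2 ≤
      l * G.pMax s t * (x ^ 2 / (2 + x))) :
    (Measure.infinitePi fun _ : ℕ => G.realizationLaw).real
      {g | ¬ ∀ I, |(coverCount (G.typeOneFamily s t g l) I : ℝ) - l * G.acceptProb s t I| ≤
        l * (x * G.pMax s t)} ≤ 1 / N := by
  have hone : ∀ I : Finset V, (Measure.infinitePi fun _ : ℕ => G.realizationLaw).real
      {g | ¬ |(coverCount (G.typeOneFamily s t g l) I : ℝ) - l * G.acceptProb s t I| ≤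
        l * (x * G.pMax s t)} ≤ 2 * Real.exp (-(l * G.pMax s t * (x ^ 2 / (2 + x)))) := by
    intro I
    simp only [G.coverCount_typeOneFamily, G.acceptProb_eq hst]
    exact measureReal_deviation_le G.realizationLaw _ l hx
      (by rw [← G.acceptProb_eq hst]; exact G.acceptProb_le_pMax s t I)
  have hset : {g : ℕ → V → Option V | ¬ ∀ I, |(coverCount (G.typeOneFamily s t g l) I : ℝ) -
      l * G.acceptProb s t I| ≤ l * (x * G.pMax s t)} =
      ⋃ I ∈ (Finset.univ : Finset (Finset V)), {g |
        ¬ |(coverCount (G.typeOneFamily s t g l) I : ℝ) - l * G.acceptProb s t I| ≤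
          l * (x * G.pMax s t)} := by
    ext g
    simp
  rw [hset]
  refine (measureReal_biUnion_finset_le _ _).trans
    ((Finset.sum_le_sum fun I _ => hone I).trans ?_)
  rw [Finset.sum_const, Finset.card_univ, Fintype.card_finset, nsmul_eq_mul]
  calc ((2 ^ Fintype.card V : ℕ) : ℝ) * (2 * Real.exp (-(l * G.pMax s t * (x ^ 2 / (2 + x)))))
      ≤ ((2 ^ Fintype.card V : ℕ) : ℝ) * (2 *
        Real.exp (-(Real.log 2 + Real.log N + Fintype.card V * Real.log 2))) := by gcongr
    _ = 1 / N := by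
      rw [Real.exp_neg, Real.exp_add, Real.exp_add, Real.exp_log (by norm_num), Real.exp_log hN,
        Real.exp_nat_mul, Real.exp_log (by norm_num)]
      push_cast
      field_simp

/-- Once the empirical acceptance rates are uniformly accurate, the output `A U p` is good:
`I_α` covers at least `β |U|` traces, so it bounds the size of the output, and the coverage of the
output bounds its acceptance probability from below. -/
theorem SocialNetwork.framework_spec (G : SocialNetwork V) {s t : V}
    (hst : ¬ G.graph.Adj s t) {α ε ε₀ ε₁ : ℝ} (hα : α ≤ 1)
    (hadm : Admissible α ε ε₀ ε₁) {A : Multiset (Finset V) → ℕ → Finset V} (hA : IsMSCApprox A)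
    {Iα : Finset V} (hI : G.IsOptimal s t α Iα) {l : ℕ} (hl : 0 < l) {g : ℕ → V → Option V}
    (h : ∀ I, |(coverCount (G.typeOneFamily s t g l) I : ℝ) - l * G.acceptProb s t I| ≤
        l * (ε₁ * (1 + ε₀) * G.pMax s t)) :
    (α - ε) * G.pMax s t ≤
        G.acceptProb s t (G.framework s t A (betaParam α ε₀ ε₁) l g) ∧
      ((G.framework s t A (betaParam α ε₀ ε₁) l g).card : ℝ) ≤
        2 * √((1 + ε₁ * (1 + ε₀)) * (l * G.pMax s t)) * Iα.card := by
  obtain ⟨h0, -, h1, -, hβ, heq⟩ := hadm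
  set x := ε₁ * (1 + ε₀) with hx
  have hx0 : 0 < x := by positivity
  set β := betaParam α ε₀ ε₁ with hβdef
  set p := G.pMax s t with hp
  set U := G.typeOneFamily s t g l with hU
  have hβx : β * (1 + x) = α - x := by
    rw [hβdef, betaParam, ← hx]
    field_simp
  have hβ1 : β ≤ 1 := by nlinarith
  have hl0 : (0 : ℝ) < l := by exact_mod_cast hl
  have huniv := abs_le.1 (h Finset.univ)
  rw [G.acceptProb_univ hst, ← G.card_typeOneFamily, ← hp, ← hU] at huniv
  have hUub : (U.card : ℝ) ≤ (1 + x) * (l * p) := by linarith [huniv.2]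
  have hUlb : (1 - x) * (l * p) ≤ U.card := by linarith [huniv.1]
  have hceil : ⌈β * (U.card : ℝ)⌉₊ ≤ U.card :=
    Nat.ceil_le.2 (mul_le_of_le_one_left (Nat.cast_nonneg _) hβ1)
  obtain ⟨hcov, hsize⟩ := hA U _ hceil
  have hout : G.framework s t A β l g = A U ⌈β * (U.card : ℝ)⌉₊ := rfl
  rw [hout]
  set J := A U ⌈β * (U.card : ℝ)⌉₊
  constructor
  · have hcov' : β * (U.card : ℝ) ≤ coverCount U J := Nat.ceil_le.1 hcov
    have hJ := (abs_le.1 (h J)).2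
    have h2 : β * ((1 - x) * (l * p)) ≤ β * U.card := by gcongr
    have h3 : l * ((α - ε) * p) ≤ l * G.acceptProb s t J := by
      rw [← heq]
      linarith
    exact le_of_mul_le_mul_left h3 hl0
  · have hIα := (abs_le.1 (h Iα)).1
    have h2 : (l : ℝ) * (α * p) ≤ l * G.acceptProb s t Iα := by gcongr; exact hI.1
    have h3 : β * (U.card : ℝ) ≤ β * ((1 + x) * (l * p)) := by gcongr
    have h4 : β * ((1 + x) * (l * p)) = (α - x) * (l * p) := by rw [← hβx]; ring
    have h5 : β * (U.card : ℝ) ≤ coverCount U Iα := by linarith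
    refine (hsize Iα (Nat.ceil_le.2 h5)).trans ?_
    gcongr

end Framework

/-! ### The sample size -/

section SampleSize

open Real

theorem sampleSize_numerator_pos {n N : ℝ} (hn : 0 ≤ n) (hN : 2 < N) :
    0 < log 2 + log N + n * log 2 := by
  have h1 : 0 < log 2 := log_pos (by norm_num)
  have h2 : 0 < log N := log_pos (by linarith)
  positivity

theorem sampleSize_pos {n : ℕ} {ε₀ ε₁ N q : ℝ} (h0' : ε₀ < 1) (h1 : 0 < ε₁)
    (hN : 2 < N) (hq : 0 < q) : 0 < sampleSize n ε₀ ε₁ N q := by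
  have hA := sampleSize_numerator_pos (Nat.cast_nonneg n) hN
  have h3 : 0 < 1 - ε₀ := by linarith
  rw [sampleSize]
  positivity

/-- The estimate `q` may exceed the mean `p` by the factor `1 + ε₀`. The sample size is still
sufficient for the relative accuracy `ε₁ (1 + ε₀)`. -/
theorem le_of_sampleSize_le {n l : ℕ} {ε₀ ε₁ N p q : ℝ} (h0 : 0 < ε₀) (h0' : ε₀ < 1)
    (h1 : 0 < ε₁) (hN : 2 < N) (hq : 0 < q) (hqp : q ≤ (1 + ε₀) * p)
    (hl : sampleSize n ε₀ ε₁ N q ≤ l) :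
    log 2 + log N + n * log 2 ≤
      l * p * ((ε₁ * (1 + ε₀)) ^ 2 / (2 + ε₁ * (1 + ε₀))) := by
  have hA := sampleSize_numerator_pos (Nat.cast_nonneg n) hN
  set B := log 2 + log N + n * log 2 with hB
  have h3 : 0 < 1 - ε₀ := by linarith
  have hp : 0 < p := by
    by_contra hp
    have : (1 + ε₀) * p ≤ 0 := mul_nonpos_of_nonneg_of_nonpos (by linarith) (not_lt.1 hp)
    linarith
  rw [sampleSize, ← hB, div_le_iff₀ (by positivity)] at hl
  rw [mul_div_assoc', le_div_iff₀ (by positivity)]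
  have hcmp : (1 - ε₀) ^ 2 * (2 + ε₁ * (1 + ε₀)) ≤ (1 + ε₀) * (2 + ε₁ * (1 - ε₀)) := by
    have e1 : (1 - ε₀) ^ 2 ≤ 1 - ε₀ := by nlinarith
    have e2 : (1 - ε₀) ^ 2 * (ε₁ * (1 + ε₀)) ≤ (1 - ε₀) * (ε₁ * (1 + ε₀)) := by gcongr
    nlinarith
  have hpos : 0 < (2 + ε₁ * (1 - ε₀)) := by positivity
  refine le_of_mul_le_mul_right ?_ hpos
  calc B * (2 + ε₁ * (1 + ε₀)) * (2 + ε₁ * (1 - ε₀))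
      = (B * (2 + ε₁ * (1 - ε₀))) * (2 + ε₁ * (1 + ε₀)) := by ring
    _ ≤ (l * (ε₁ ^ 2 * (1 - ε₀) ^ 2 * q)) * (2 + ε₁ * (1 + ε₀)) := by gcongr
    _ ≤ (l * (ε₁ ^ 2 * (1 - ε₀) ^ 2 * ((1 + ε₀) * p))) * (2 + ε₁ * (1 + ε₀)) := by gcongr
    _ = l * ε₁ ^ 2 * (1 + ε₀) * p * ((1 - ε₀) ^ 2 * (2 + ε₁ * (1 + ε₀))) := by ring
    _ ≤ l * ε₁ ^ 2 * (1 + ε₀) * p * ((1 + ε₀) * (2 + ε₁ * (1 - ε₀))) := by gcongr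
    _ = _ := by ring

/-- A bound on `l p_max / n`, where `l` is the sample size, for `N ≤ c * n ^ K`. -/
noncomputable def sampleSizeBound (ε₀ ε₁ c : ℝ) (K : ℕ) : ℝ :=
  (2 + |log c| + K) * (2 + ε₁ * (1 - ε₀)) / (ε₁ ^ 2 * (1 - ε₀) ^ 3) + 1

theorem ceil_sampleSize_mul_le {n K : ℕ} {ε₀ ε₁ c N p q : ℝ} (hn : 0 < n) (h0' : ε₀ < 1)
    (h1 : 0 < ε₁) (hN : 2 < N) (hNc : N ≤ c * (n : ℝ) ^ K) (hp : 0 < p) (hp1 : p ≤ 1)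
    (hqp : (1 - ε₀) * p ≤ q) :
    (⌈sampleSize n ε₀ ε₁ N q⌉₊ : ℝ) * p ≤ sampleSizeBound ε₀ ε₁ c K * n := by
  have hn1 : (1 : ℝ) ≤ n := by exact_mod_cast hn
  have h3 : 0 < 1 - ε₀ := by linarith
  have hq : 0 < q := lt_of_lt_of_le (by positivity) hqp
  have hc : 0 < c := by
    by_contra hc
    have : c * (n : ℝ) ^ K ≤ 0 := mul_nonpos_of_nonpos_of_nonneg (not_lt.1 hc) (by positivity)
    linarith
  have hlogN : log N ≤ |log c| * n + K * n := by
    calc log N ≤ log (c * (n : ℝ) ^ K) := log_le_log (by linarith) hNc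
      _ = log c + K * log n := by rw [log_mul hc.ne' (by positivity), log_pow]
      _ ≤ |log c| * n + K * n := by
        have e1 : log c ≤ |log c| * n :=
          (le_abs_self _).trans (le_mul_of_one_le_right (abs_nonneg _) hn1)
        have e2 : log n ≤ n := (log_le_sub_one_of_pos (by linarith)).trans (by linarith)
        gcongr
  have hlog2 : log 2 ≤ 1 := by linarith [log_le_sub_one_of_pos (show (0 : ℝ) < 2 by norm_num)]
  have hA : log 2 + log N + n * log 2 ≤ (2 + |log c| + K) * n := by nlinarith
  have hA0 := sampleSize_numerator_pos (Nat.cast_nonneg n) hN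
  have hmain : sampleSize n ε₀ ε₁ N q * p ≤
      (2 + |log c| + K) * (2 + ε₁ * (1 - ε₀)) / (ε₁ ^ 2 * (1 - ε₀) ^ 3) * n := by
    calc sampleSize n ε₀ ε₁ N q * p
        ≤ ((2 + |log c| + K) * n) * (2 + ε₁ * (1 - ε₀)) /
            (ε₁ ^ 2 * (1 - ε₀) ^ 2 * ((1 - ε₀) * p)) * p := by
          rw [sampleSize]; gcongr
      _ = _ := by field_simp
  have hceil := (Nat.ceil_lt_add_one (sampleSize_pos (n := n) h0' h1 hN hq).le).le
  calc (⌈sampleSize n ε₀ ε₁ N q⌉₊ : ℝ) * p ≤ (sampleSize n ε₀ ε₁ N q + 1) * p := by gcongr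
    _ = sampleSize n ε₀ ε₁ N q * p + p := by ring
    _ ≤ _ := by rw [sampleSizeBound]; linarith

end SampleSize

/-! ### The guarantee of RAF -/

section Guarantee

variable {V : Type*} [Fintype V] [DecidableEq V]

/-- The constant of the approximation ratio. -/
noncomputable def rafConstant (ε₀ ε₁ c : ℝ) (K : ℕ) : ℝ :=
  2 * √((1 + ε₁ * (1 + ε₀)) * sampleSizeBound ε₀ ε₁ c K)

theorem SocialNetwork.raf_spec (G : SocialNetwork V) {s t : V}
    (hst : ¬ G.graph.Adj s t) (hpos : 0 < G.pMax s t) {α ε ε₀ ε₁ : ℝ} (hα : α ≤ 1)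
    (hadm : Admissible α ε ε₀ ε₁) {A : Multiset (Finset V) → ℕ → Finset V} (hA : IsMSCApprox A)
    {c N : ℝ} {K : ℕ} (hN : 0 < N) (hNc : N ≤ c * (Fintype.card V : ℝ) ^ K) {Iα : Finset V}
    (hI : G.IsOptimal s t α Iα) :
    1 - 2 / N ≤ G.sampleLaw.real
      {ω | ∃ I : Finset V, G.raf s t A α ε₀ ε₁ N ω = some I ∧
        (α - ε) * G.pMax s t ≤ G.acceptProb s t I ∧
        (I.card : ℝ) ≤ rafConstant ε₀ ε₁ c K * √(Fintype.card V : ℝ) * (Iα.card : ℝ)} := by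
  rcases le_or_gt N 2 with hN2 | hN2
  · have : 1 ≤ 2 / N := by rwa [le_div_iff₀ hN, one_mul]
    exact le_trans (by linarith) measureReal_nonneg
  obtain ⟨h0, h0', h1, -, -, -⟩ := id hadm
  set p := G.pMax s t with hp
  set S : Set (V → Option V) := {g | (G.trace s t g).isSome} with hS
  have hpS : p = G.realizationLaw.real S := G.pMax_eq hst
  have hp1 : p ≤ 1 := by rw [hpS]; exact measureReal_le_one
  have hU : 0 < upsilon ε₀ N := zero_lt_one.trans_le (one_le_upsilon h0 hN2)
  have hcard : 0 < Fintype.card V := Fintype.card_pos_iff.2 ⟨s⟩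
  -- `acc i`: the estimate is accurate if the first stream stops after `i` draws, and `l i` is the
  -- sample size that it then yields. `E i`: the stream does so. `B i`: the estimate is accurate, but
  -- the second stream has a badly off rate.
  set acc : ℕ → Prop := fun i =>
    (1 - ε₀) * p ≤ upsilon ε₀ N / i ∧ upsilon ε₀ N / i ≤ (1 + ε₀) * p with hacc
  set l : ℕ → ℕ := fun i => ⌈sampleSize (Fintype.card V) ε₀ ε₁ N (upsilon ε₀ N / i)⌉₊ with hl
  set E : ℕ → Set (ℕ → V → Option V) := fun i => {g | IsStop S (upsilon ε₀ N) g i} with hE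
  set B : ℕ → Set (ℕ → V → Option V) := fun i => {g | acc i ∧
    ¬ ∀ I, |(coverCount (G.typeOneFamily s t g (l i)) I : ℝ) - l i * G.acceptProb s t I| ≤
        l i * (ε₁ * (1 + ε₀) * p)} with hB
  have hq : ∀ i, acc i → 0 < upsilon ε₀ N / i := fun i hi =>
    lt_of_lt_of_le (mul_pos (by linarith) hpos) hi.1
  have hBle : ∀ i, (Measure.infinitePi fun _ : ℕ => G.realizationLaw).real (B i) ≤ 1 / N := by
    intro i
    by_cases hi : acc i
    · refine (measureReal_mono fun g hg => hg.2).trans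
        (G.measureReal_not_uniform_le hst (by positivity) hN ?_)
      exact le_of_sampleSize_le h0 h0' h1 hN2 (hq i hi) hi.2 (Nat.le_ceil _)
    · have : B i = ∅ := by
        ext g
        simp [hB, hi]
      rw [this, measureReal_empty]
      positivity
  have hfirst : G.sampleLaw.real {ω | ¬ ∃ i, ω.1 ∈ E i ∧ acc i} ≤ 1 / N := by
    have hprod : {ω : (ℕ → V → Option V) × (ℕ → V → Option V) | ¬ ∃ i, ω.1 ∈ E i ∧ acc i} =
        {g | ¬ ∃ i, g ∈ E i ∧ acc i} ×ˢ Set.univ := by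
      ext ω
      simp
    rw [hprod, SocialNetwork.sampleLaw, measureReal_prod_prod, probReal_univ, mul_one]
    have := measureReal_not_estimate_le G.realizationLaw S (hpS ▸ hpos) h0 h0' hN2
    rwa [← hpS] at this
  have hsecond : G.sampleLaw.real {ω | ∃ i, ω.1 ∈ E i ∧ ω.2 ∈ B i} ≤ 1 / N :=
    prod_real_exists_le _ _ (fun i => measurableSet_isStop S _ i)
      (fun i j hij => Set.disjoint_left.2 fun g hi hj => hij (IsStop.unique hi hj))
      (by positivity) hBle
  have : IsProbabilityMeasure G.sampleLaw := by
    unfold SocialNetwork.sampleLaw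
    infer_instance
  set good := {ω | ∃ I : Finset V, G.raf s t A α ε₀ ε₁ N ω = some I ∧
        (α - ε) * p ≤ G.acceptProb s t I ∧
        (I.card : ℝ) ≤ rafConstant ε₀ ε₁ c K * √(Fintype.card V : ℝ) * (Iα.card : ℝ)} with hgood
  have hcover : Set.univ ⊆ good ∪ ({ω | ¬ ∃ i, ω.1 ∈ E i ∧ acc i} ∪
      {ω | ∃ i, ω.1 ∈ E i ∧ ω.2 ∈ B i}) := by
    intro ω _
    by_cases hω1 : ∃ i, ω.1 ∈ E i ∧ acc i
    swap
    · exact Or.inr (Or.inl hω1)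
    by_cases hω2 : ∃ i, ω.1 ∈ E i ∧ ω.2 ∈ B i
    · exact Or.inr (Or.inr hω2)
    obtain ⟨i, hiE, hi⟩ := hω1
    have hunif : ∀ I, |(coverCount (G.typeOneFamily s t ω.2 (l i)) I : ℝ) -
        l i * G.acceptProb s t I| ≤ l i * (ε₁ * (1 + ε₀) * p) := by
      by_contra hcon
      exact hω2 ⟨i, hiE, hi, hcon⟩
    have hli : 0 < l i := Nat.ceil_pos.2 (sampleSize_pos h0' h1 hN2 (hq i hi))
    obtain ⟨hf, hsize⟩ := G.framework_spec hst hα hadm hA hI hli hunif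
    refine Or.inl ⟨G.framework s t A (betaParam α ε₀ ε₁) (l i) ω.2, ?_, hf, hsize.trans ?_⟩
    · rw [SocialNetwork.raf, G.estimate_eq_some hiE, Option.map_some]
    · have hlp := ceil_sampleSize_mul_le hcard h0' h1 hN2 hNc hpos hp1 hi.1
      have hsqrt : rafConstant ε₀ ε₁ c K * √(Fintype.card V : ℝ) =
          2 * √((1 + ε₁ * (1 + ε₀)) * (sampleSizeBound ε₀ ε₁ c K * Fintype.card V)) := by
        rw [rafConstant, mul_assoc, ← Real.sqrt_mul' _ (Nat.cast_nonneg _), mul_assoc]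
      rw [hsqrt]
      gcongr
  have htotal : (1 : ℝ) ≤ G.sampleLaw.real good + (1 / N + 1 / N) := by
    calc (1 : ℝ) = G.sampleLaw.real Set.univ := probReal_univ.symm
      _ ≤ _ := measureReal_mono hcover
      _ ≤ _ := (measureReal_union_le _ _).trans (add_le_add le_rfl
        ((measureReal_union_le _ _).trans (add_le_add hfirst hsecond)))
  have : 2 / N = 1 / N + 1 / N := by ring
  linarith

end Guarantee

end ActiveFriending

theorem theorem1 :
    -- the parameters of RAF can always be determined
    (∀ α ε : ℝ, α ≤ 1 → 0 < ε → ε < α → ∃ ε₀ ε₁ : ℝ, ActiveFriending.Admissible α ε ε₀ ε₁) ∧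
    -- the Chlamtáč algorithm is an admissible subroutine
    (∀ (V : Type*) [Fintype V] [DecidableEq V],
      ActiveFriending.IsMSCApprox (ActiveFriending.chlamtac (V := V))) ∧
    -- the guarantee of RAF; the constant `C` depends only on `ε₀`, `ε₁` and the bound `c * n ^ K`
    (∀ (ε₀ ε₁ c : ℝ) (K : ℕ), ∃ C : ℝ,
      ∀ (α ε : ℝ), α ≤ 1 → 0 < ε → ε < α → ActiveFriending.Admissible α ε ε₀ ε₁ →
      ∀ (V : Type*) [Fintype V] [DecidableEq V] (G : ActiveFriending.SocialNetwork V) (s t : V),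
        s ≠ t → ¬ G.graph.Adj s t → 0 < G.pMax s t →
      ∀ (A : Multiset (Finset V) → ℕ → Finset V), ActiveFriending.IsMSCApprox A →
      ∀ (N : ℝ), 0 < N → N ≤ c * (Fintype.card V : ℝ) ^ K →
      ∀ (Iα : Finset V), G.IsOptimal s t α Iα →
        1 - 2 / N ≤ G.sampleLaw.real
          {ω | ∃ I : Finset V, G.raf s t A α ε₀ ε₁ N ω = some I ∧
            (α - ε) * G.pMax s t ≤ G.acceptProb s t I ∧
            (I.card : ℝ) ≤ C * √(Fintype.card V : ℝ) * (Iα.card : ℝ)}) :=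
  ⟨fun _ _ hα hε hεα => ActiveFriending.exists_admissible hα hε hεα,
    fun _ => ActiveFriending.isMSCApprox_chlamtac,
    fun ε₀ ε₁ c K => ⟨ActiveFriending.rafConstant ε₀ ε₁ c K,
      fun _ _ hα _ _ hadm _ _ _ G _ _ _ hst hpos _ hA _ hN hNc _ hI =>
        G.raf_spec hst hpos hα hadm hA hN hNc hI⟩⟩
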